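/- **Setting.** For $q>0$ put $[t]_q=(q^t-q^{-t})/(q-q^{-1})$ if $q\neq1$ and $[t]_1=t$. For $S\in\frac12\mathbb Z_{\ge0}$ let $n=2S+1$ and let $\mathcal H^q_S=\mathbb C^n$ be the irreducible spin-$S$ $*$-module of $U_q(su_2)$ (of $U(su_2)$ if $q=1$), with orthonormal basis $|m\rangle$, $m=S,S-1,\dots,-S$, and $$X^{+}|m\rangle=\sqrt{[S-m]_q[S+m+1]_q}\,|m+1\rangle,\quad X^-=(X^+)^*,\quad K|m\rangle=q^m|m\rangle,\quad H|m\rangle=m|m\rangle .$$ The comultiplication is $\Delta(X^\pm)=X^\pm\otimes K+K^{-1}\otimes X^\pm$, $\Delta(K^{\pm1})=K^{\pm1}\otimes K^{\pm1}$ for $q\ne1$, and $\Delta(X^\pm)=X^\pm\otimes1+1\otimes X^\pm$, $\Delta(H)=H\otimes1+1\otimes H$ for $q=1$. The Casimir elements are $C_q=X^-X^++\frac{(K-K^{-1})(qK-q^{-1}K^{-1})}{(q-q^{-1})^2}$ for $q\ne1$ and $C_1=X^-X^++H(H+1)$. For integers $0\le J\le 2S$ and $-J\le m\le J$, let $|J,m\rangle_q\in\mathcal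 H^q_S\otimes\mathcal H^q_S$ be the unit joint eigenvector (unique up to a phase) of $\Delta(K)$ and $\Delta(C_q)$ with eigenvalues $q^m$ and $[J]_q[J+1]_q$ (for $q=1$: of $\Delta(H)$ and $\Delta(C_1)$ with eigenvalues $m$ and $J(J+1)$). A pair of orthogonal vectors $|J_1,m_1\rangle_q$, $|J_2,m_2\rangle_q$ is called a *TL pair*, with value $Q>0$, if $T=QP$, where $P$ is the orthogonal projection of $\mathcal H^q_S\otimes\mathcal H^q_S$ onto their span, satisfies $$T^*=T,\quad T^2=QT,\quad T_{12}T_{23}T_{12}=T_{12},\quad T_{23}T_{12}T_{23}=T_{23},$$ where $T_{12}=T\otimes I_n$ and $T_{23}=I_n\otimes T$. Pairs are considered up to the order of the two vectors, written so that $J_1\ge J_2$. **Theorem.** a) For $q=1$, the exhaustive list of TL pairs $|J_1,m_1\rangle_{1},|J_2,m_2\rangle_{1}$ with $J_1\ge J_2$ is: (i) $|1,m\rangle_1,|1,-m\rangle_1$; (ii) $|1,m\rangle_1,|1,0\rangle_1$; (iii) $|2,m\rangle_1,|1,-m\rangle_1$; (iv) $|2,m\rangle_1,|1,0\rangle_1$;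 (v) $|2,m\rangle_1,|2,-m\rangle_1$; in all cases $S=1$ and $m=\pm1$. For each of them $Q=2$ is the one value of $Q>0$ for which $QP$ satisfies the relations. b) The exhaustive list of pairs $|J_1,m_1\rangle_q,|J_2,m_2\rangle_q$ with $J_1\ge J_2$ that are TL pairs for all $q>0$ is: (i) $|2,1\rangle_q,|1,-1\rangle_q$; (ii) $|2,-1\rangle_q,|1,1\rangle_q$; in both cases $S=1$. For each of them and each $q>0$, $Q=q^2+q^{-2}$ is the one value of $Q>0$ for which $QP$ satisfies the relations. -/

import Mathlib

open scoped Kronecker Matrix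

namespace TLPairs

noncomputable section

/-! ### The Temperley-Lieb relations for a matrix on `ℂⁿ ⊗ ℂⁿ` -/

/-- Operators on `ℂⁿ ⊗ ℂⁿ`, as matrices in the basis `e_a ⊗ e_b`. -/
abbrev Op2 (n : ℕ) : Type := Matrix (Fin n × Fin n) (Fin n × Fin n) ℂ

/-- Operators on `ℂⁿ ⊗ ℂⁿ ⊗ ℂⁿ`, as matrices in the basis `e_a ⊗ e_b ⊗ e_c`. -/
abbrev Op3 (n : ℕ) : Type :=
  Matrix (Fin n × Fin n × Fin n) (Fin n × Fin n × Fin n) ℂ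

/-- `T₁₂ = T ⊗ I`. -/
def act12 {n : ℕ} (T : Op2 n) : Op3 n :=
  Matrix.reindex (Equiv.prodAssoc _ _ _) (Equiv.prodAssoc _ _ _)
    (T ⊗ₖ (1 : Matrix (Fin n) (Fin n) ℂ))

/-- `T₂₃ = I ⊗ T`. -/
def act23 {n : ℕ} (T : Op2 n) : Op3 n :=
  (1 : Matrix (Fin n) (Fin n) ℂ) ⊗ₖ T

/-- The four relations that define a unitary tensor space representation of the
Temperley-Lieb algebra with loop parameter `Q`. -/
structure IsTLSolution {n : ℕ} (Q : ℝ) (T : Op2 n) : Prop where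
  hermitian : Tᴴ = T
  quadratic : T * T = (Q : ℂ) • T
  braid12 : act12 T * act23 T * act12 T = act12 T
  braid23 : act23 T * act12 T * act23 T = act23 T

/-! ### The spin `S` module of `U_q(su₂)` and its tensor square

Throughout `d = 2 S`, so that `n = 2 S + 1 = d + 1`, and the basis vector `e_a`,
`a = 0, …, d`, is the weight vector `|S - a⟩`. -/

/-- The `q`-number `[t]_q = (q^t - q^(-t)) / (q - q⁻¹)`, with `[t]_1 = t`. -/
def qNum (q t : ℝ) : ℝ :=
  if q = 1 then t else (q ^ t - q ^ (-t)) / (q - q⁻¹)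

/-- The weight `S - a` of the basis vector `e_a`. -/
def weight (d : ℕ) (a : Fin (d + 1)) : ℝ := (d : ℝ) / 2 - (a : ℝ)

/-- Operators on the spin `d / 2` module. -/
abbrev Op1 (d : ℕ) : Type := Matrix (Fin (d + 1)) (Fin (d + 1)) ℂ

/-- The raising operator, `X⁺ |m⟩ = √([S - m]_q [S + m + 1]_q) |m + 1⟩`. -/
def raise (d : ℕ) (q : ℝ) : Op1 d :=
  Matrix.of fun a b =>
    if (a : ℕ) + 1 = (b : ℕ) then
      ((Real.sqrt (qNum q ((d : ℝ) / 2 - weight d b) *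
        qNum q ((d : ℝ) / 2 + weight d b + 1)) : ℝ) : ℂ)
    else 0

/-- The lowering operator `X⁻ = (X⁺)*`. -/
def lower (d : ℕ) (q : ℝ) : Op1 d := (raise d q)ᴴ

/-- `K |m⟩ = q^m |m⟩` (the identity for `q = 1`). -/
def opK (d : ℕ) (q : ℝ) : Op1 d :=
  Matrix.diagonal fun a => ((q ^ weight d a : ℝ) : ℂ)

/-- `K⁻¹ |m⟩ = q^(-m) |m⟩` (the identity for `q = 1`). -/
def opKinv (d : ℕ) (q : ℝ) : Op1 d :=
  Matrix.diagonal fun a => ((q ^ (-weight d a) : ℝ) : ℂ)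

/-- `H |m⟩ = m |m⟩`. -/
def opH (d : ℕ) : Op1 d := Matrix.diagonal fun a => ((weight d a : ℝ) : ℂ)

/-- The comultiplication of `X = X⁺` or `X = X⁻`: `X ⊗ K + K⁻¹ ⊗ X`, which for `q = 1`
is `X ⊗ 1 + 1 ⊗ X`. -/
def deltaX (d : ℕ) (q : ℝ) (X : Op1 d) : Op2 (d + 1) :=
  X ⊗ₖ opK d q + opKinv d q ⊗ₖ X

/-- `Δ(K) = K ⊗ K`. -/
def deltaK (d : ℕ) (q : ℝ) : Op2 (d + 1) := opK d q ⊗ₖ opK d q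

/-- `Δ(K⁻¹) = K⁻¹ ⊗ K⁻¹`. -/
def deltaKinv (d : ℕ) (q : ℝ) : Op2 (d + 1) := opKinv d q ⊗ₖ opKinv d q

/-- `Δ(H) = H ⊗ 1 + 1 ⊗ H`. -/
def deltaH (d : ℕ) : Op2 (d + 1) :=
  opH d ⊗ₖ (1 : Op1 d) + (1 : Op1 d) ⊗ₖ opH d

/-- `Δ(C₁)`, where `C₁ = X⁻ X⁺ + H (H + 1)` is the Casimir element of `U(su₂)`. -/
def deltaCasimirOne (d : ℕ) : Op2 (d + 1) :=
  deltaX d 1 (lower d 1) * deltaX d 1 (raise d 1) + deltaH d * (deltaH d + 1)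

/-- `Δ(C_q)`, where `C_q = X⁻ X⁺ + (K - K⁻¹)(q K - q⁻¹ K⁻¹) / (q - q⁻¹)²` is the Casimir
element of `U_q(su₂)`, `q ≠ 1`. -/
def deltaCasimir (d : ℕ) (q : ℝ) : Op2 (d + 1) :=
  deltaX d q (lower d q) * deltaX d q (raise d q) +
    (((q - q⁻¹) ^ 2 : ℝ) : ℂ)⁻¹ •
      ((deltaK d q - deltaKinv d q) *
        ((q : ℂ) • deltaK d q - ((q⁻¹ : ℝ) : ℂ) • deltaKinv d q))

/-- `v` is a vector `|J,m⟩_q` of the tensor square of the spin `d / 2` module: a unit joint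
eigenvector of `Δ(K)` and `Δ(C_q)` with eigenvalues `q^m` and `[J]_q [J+1]_q` (of `Δ(H)` and
`Δ(C₁)` with eigenvalues `m` and `J (J + 1)`, if `q = 1`), where `0 ≤ J ≤ d` and
`-J ≤ m ≤ J`. It is determined up to a phase. -/
def IsKet (d : ℕ) (q : ℝ) (J : ℕ) (m : ℤ) (v : Fin (d + 1) × Fin (d + 1) → ℂ) : Prop :=
  J ≤ d ∧ |m| ≤ (J : ℤ) ∧ star v ⬝ᵥ v = 1 ∧
  (q = 1 →
    deltaH d *ᵥ v = (m : ℂ) • v ∧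
    deltaCasimirOne d *ᵥ v = ((J : ℂ) * ((J : ℂ) + 1)) • v) ∧
  (q ≠ 1 →
    deltaK d q *ᵥ v = ((q ^ m : ℝ) : ℂ) • v ∧
    deltaCasimir d q *ᵥ v = ((qNum q (J : ℝ) * qNum q ((J : ℝ) + 1) : ℝ) : ℂ) • v)

/-! ### TL pairs -/

/-- `P` is the orthogonal projection onto the span of `v₁` and `v₂`. -/
def IsProjOnSpan {n : ℕ} (P : Op2 n) (v₁ v₂ : Fin n × Fin n → ℂ) : Prop :=
  Pᴴ = P ∧ P * P = P ∧ LinearMap.range P.mulVecLin = Submodule.span ℂ {v₁, v₂}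

/-- `|J₁,m₁⟩_q` and `|J₂,m₂⟩_q` (for spin `d / 2`) are orthogonal and `T = Q P` satisfies the
Temperley-Lieb relations, where `P` is the orthogonal projection onto their span. -/
def IsTLPairWith (d : ℕ) (q Q : ℝ) (J₁ : ℕ) (m₁ : ℤ) (J₂ : ℕ) (m₂ : ℤ) : Prop :=
  ∃ v₁ v₂ : Fin (d + 1) × Fin (d + 1) → ℂ, ∃ P : Op2 (d + 1),
    IsKet d q J₁ m₁ v₁ ∧ IsKet d q J₂ m₂ v₂ ∧ star v₁ ⬝ᵥ v₂ = 0 ∧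
    IsProjOnSpan P v₁ v₂ ∧ IsTLSolution Q ((Q : ℂ) • P)

/-- `|J₁,m₁⟩_q` and `|J₂,m₂⟩_q` (for spin `d / 2`) form a TL pair. -/
def IsTLPair (d : ℕ) (q : ℝ) (J₁ : ℕ) (m₁ : ℤ) (J₂ : ℕ) (m₂ : ℤ) : Prop :=
  ∃ Q : ℝ, 0 < Q ∧ IsTLPairWith d q Q J₁ m₁ J₂ m₂

end

end TLPairs

namespace TLPairs

/-! ### The Temperley-Lieb relations for a projection of rank two -/

section Criterion

variable {n : ℕ}

/-- The sum of the rank one operators `|v_i⟩⟨v_i|`. -/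
def spanProj (v : Fin 2 → Fin n × Fin n → ℂ) : Op2 n :=
  ∑ i, Matrix.vecMulVec (v i) (star (v i))

/-- Orthonormality of a pair of vectors. -/
def IsOrtho (v : Fin 2 → Fin n × Fin n → ℂ) : Prop :=
  ∀ i k, star (v i) ⬝ᵥ v k = if i = k then 1 else 0

/-- The columns `v_i ⊗ e_c`. -/
def leftCols (v : Fin 2 → Fin n × Fin n → ℂ) :
    Matrix (Fin n × Fin n × Fin n) (Fin 2 × Fin n) ℂ :=
  Matrix.of fun x y => if x.2.2 = y.2 then v y.1 (x.1, x.2.1) else 0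

/-- The columns `e_a ⊗ v_j`. -/
def rightCols (v : Fin 2 → Fin n × Fin n → ℂ) :
    Matrix (Fin n × Fin n × Fin n) (Fin 2 × Fin n) ℂ :=
  Matrix.of fun x y => if x.1 = y.2 then v y.1 x.2 else 0

/-- The overlaps `⟨e_a ⊗ v_j, v_k ⊗ e_c⟩`. -/
def overlap (v : Fin 2 → Fin n × Fin n → ℂ) : Matrix (Fin 2 × Fin n) (Fin 2 × Fin n) ℂ :=
  Matrix.of fun x y => ∑ b, star (v x.1 (b, y.2)) * v y.1 (x.2, b)

lemma spanProj_apply (v : Fin 2 → Fin n × Fin n → ℂ) (x y : Fin n × Fin n) :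
    spanProj v x y = ∑ i, v i x * star (v i y) := by
  simp [spanProj, Matrix.sum_apply, Matrix.vecMulVec_apply]

lemma act12_spanProj (v : Fin 2 → Fin n × Fin n → ℂ) :
    act12 (spanProj v) = leftCols v * (leftCols v)ᴴ := by
  ext ⟨a, b, c⟩ ⟨a', b', c'⟩
  simp only [act12, Matrix.reindex_apply, Matrix.submatrix_apply, Equiv.prodAssoc_symm_apply,
    Matrix.kroneckerMap_apply, spanProj_apply, Matrix.mul_apply, Matrix.conjTranspose_apply,
    leftCols, Matrix.of_apply, Fintype.sum_prod_type, Matrix.one_apply, Finset.sum_mul]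
  refine Finset.sum_congr rfl fun i _ => ?_
  rw [Finset.sum_eq_single c]
  · by_cases h : c = c' <;> simp [h, eq_comm]
  · intro x _ hx
    simp [Ne.symm hx]
  · simp

lemma act23_spanProj (v : Fin 2 → Fin n × Fin n → ℂ) :
    act23 (spanProj v) = rightCols v * (rightCols v)ᴴ := by
  ext ⟨a, b, c⟩ ⟨a', b', c'⟩
  simp only [act23, Matrix.kroneckerMap_apply, spanProj_apply, Matrix.mul_apply,
    Matrix.conjTranspose_apply, rightCols, Matrix.of_apply, Fintype.sum_prod_type,
    Matrix.one_apply, Finset.mul_sum]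
  refine Finset.sum_congr rfl fun i _ => ?_
  rw [Finset.sum_eq_single a]
  · by_cases h : a = a' <;> simp [h, eq_comm]
  · intro x _ hx
    simp [Ne.symm hx]
  · simp

lemma leftCols_isometry {v : Fin 2 → Fin n × Fin n → ℂ} (hv : IsOrtho v) :
    (leftCols v)ᴴ * leftCols v = 1 := by
  ext ⟨i, c⟩ ⟨k, c'⟩
  have h := hv i k
  simp only [dotProduct, Fintype.sum_prod_type, Pi.star_apply] at h
  simp only [leftCols, Matrix.mul_apply, Matrix.conjTranspose_apply, Matrix.of_apply,
    Fintype.sum_prod_type, Matrix.one_apply, Prod.mk.injEq]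
  by_cases hc : c = c'
  · subst hc
    simpa using h
  · simp only [hc, and_false, if_false]
    refine Finset.sum_eq_zero fun a _ => Finset.sum_eq_zero fun b _ =>
      Finset.sum_eq_zero fun x _ => ?_
    by_cases h1 : x = c
    · subst h1; simp [hc]
    · simp [h1]

lemma rightCols_isometry {v : Fin 2 → Fin n × Fin n → ℂ} (hv : IsOrtho v) :
    (rightCols v)ᴴ * rightCols v = 1 := by
  ext ⟨i, c⟩ ⟨k, c'⟩
  have h := hv i k
  simp only [dotProduct, Fintype.sum_prod_type, Pi.star_apply] at h
  simp only [rightCols, Matrix.mul_apply, Matrix.conjTranspose_apply, Matrix.of_apply,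
    Fintype.sum_prod_type, Matrix.one_apply, Prod.mk.injEq]
  rw [Finset.sum_eq_single c]
  · by_cases hc : c = c'
    · subst hc
      simpa using h
    · simp [hc]
  · intro x _ hx
    simp [hx]
  · simp

lemma overlap_eq (v : Fin 2 → Fin n × Fin n → ℂ) :
    (rightCols v)ᴴ * leftCols v = overlap v := by
  ext ⟨j, a⟩ ⟨k, c⟩
  simp only [overlap, rightCols, leftCols, Matrix.mul_apply, Matrix.conjTranspose_apply,
    Matrix.of_apply, Fintype.sum_prod_type]
  rw [Finset.sum_eq_single a]
  · simp
  · intro x _ hx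
    simp [hx]
  · simp

lemma spanProj_conjTranspose (v : Fin 2 → Fin n × Fin n → ℂ) :
    (spanProj v)ᴴ = spanProj v := by
  ext x y
  simp [Matrix.conjTranspose_apply, spanProj_apply, mul_comm]

lemma spanProj_mulVec (v : Fin 2 → Fin n × Fin n → ℂ) (x : Fin n × Fin n → ℂ) :
    spanProj v *ᵥ x = ∑ i, (star (v i) ⬝ᵥ x) • v i := by
  simp only [spanProj, Matrix.sum_mulVec, Matrix.vecMulVec_mulVec]
  simp

lemma spanProj_mulVec_self {v : Fin 2 → Fin n × Fin n → ℂ} (hv : IsOrtho v) (k : Fin 2) :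
    spanProj v *ᵥ v k = v k := by
  rw [spanProj_mulVec, Finset.sum_eq_single k]
  · simp [hv k k]
  · intro i _ hi
    simp [hv i k, hi]
  · simp

lemma mul_spanProj (v : Fin 2 → Fin n × Fin n → ℂ) (A : Op2 n)
    (hA : ∀ i, A *ᵥ v i = v i) : A * spanProj v = spanProj v := by
  simp only [spanProj, Finset.mul_sum, Matrix.mul_vecMulVec, hA]

lemma isProjOnSpan_iff {v : Fin 2 → Fin n × Fin n → ℂ} (hv : IsOrtho v) (P : Op2 n) :
    IsProjOnSpan P (v 0) (v 1) ↔ P = spanProj v := by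
  constructor
  · rintro ⟨hP, hPP, hr⟩
    have hmem : ∀ i, v i ∈ LinearMap.range P.mulVecLin := by
      intro i
      rw [hr]
      fin_cases i
      · exact Submodule.subset_span (by simp)
      · exact Submodule.subset_span (by simp)
    have hfix : ∀ i, P *ᵥ v i = v i := by
      intro i
      obtain ⟨x, hx⟩ := hmem i
      rw [← hx, Matrix.mulVecLin_apply, Matrix.mulVec_mulVec, hPP]
    have h1 : P * spanProj v = spanProj v := mul_spanProj v P hfix
    have h2 : spanProj v * P = P := by
      refine Matrix.ext_of_mulVec_single fun x => ?_
      rw [← Matrix.mulVec_mulVec]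
      have hx : P *ᵥ Pi.single x 1 ∈ Submodule.span ℂ {v 0, v 1} := by
        rw [← hr]; exact ⟨_, rfl⟩
      obtain ⟨α, β, hab⟩ := Submodule.mem_span_pair.1 hx
      rw [← hab, Matrix.mulVec_add, Matrix.mulVec_smul, Matrix.mulVec_smul,
        spanProj_mulVec_self hv, spanProj_mulVec_self hv]
    have h3 := congrArg Matrix.conjTranspose h2
    rw [Matrix.conjTranspose_mul, hP, spanProj_conjTranspose, h1] at h3
    exact h3.symm
  · rintro rfl
    refine ⟨spanProj_conjTranspose v, mul_spanProj v _ (spanProj_mulVec_self hv), ?_⟩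
    apply le_antisymm
    · rintro _ ⟨x, rfl⟩
      rw [Matrix.mulVecLin_apply, spanProj_mulVec, Fin.sum_univ_two]
      exact Submodule.mem_span_pair.2 ⟨_, _, rfl⟩
    · rw [Submodule.span_le]
      rintro _ (rfl | rfl)
      · exact ⟨v 0, spanProj_mulVec_self hv 0⟩
      · exact ⟨v 1, spanProj_mulVec_self hv 1⟩

lemma act12_smul (c : ℂ) (T : Op2 n) : act12 (c • T) = c • act12 T := by
  ext ⟨a, b, e⟩ ⟨a', b', e'⟩
  simp [act12, mul_assoc]

lemma act23_smul (c : ℂ) (T : Op2 n) : act23 (c • T) = c • act23 T := by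
  ext ⟨a, b, e⟩ ⟨a', b', e'⟩
  simp [act23, mul_left_comm]

lemma isTLSolution_iff {v : Fin 2 → Fin n × Fin n → ℂ} (hv : IsOrtho v) {Q : ℝ} (hQ : 0 < Q) :
    IsTLSolution Q ((Q : ℂ) • spanProj v) ↔
      ((Q : ℂ) ^ 2) • ((overlap v)ᴴ * overlap v) = 1 := by
  have hQ' : (Q : ℂ) ≠ 0 := by exact_mod_cast hQ.ne'
  have hL := leftCols_isometry hv
  have hR := rightCols_isometry hv
  have hN := overlap_eq v
  have hN' : (leftCols v)ᴴ * rightCols v = (overlap v)ᴴ := by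
    rw [← hN, Matrix.conjTranspose_mul, Matrix.conjTranspose_conjTranspose]
  set L := leftCols v with hLdef
  set R := rightCols v with hRdef
  set N := overlap v with hNdef
  have e1 : act12 ((Q : ℂ) • spanProj v) * act23 ((Q : ℂ) • spanProj v) *
      act12 ((Q : ℂ) • spanProj v) = (Q : ℂ) • (L * (((Q : ℂ) ^ 2) • (Nᴴ * N)) * Lᴴ) := by
    rw [act12_smul, act23_smul, act12_spanProj, act23_spanProj, ← hLdef, ← hRdef, ← hN', ← hN]
    simp only [Matrix.smul_mul, Matrix.mul_smul, smul_smul, Matrix.mul_assoc]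
    congr 1; ring
  have e2 : act23 ((Q : ℂ) • spanProj v) * act12 ((Q : ℂ) • spanProj v) *
      act23 ((Q : ℂ) • spanProj v) = (Q : ℂ) • (R * (((Q : ℂ) ^ 2) • (N * Nᴴ)) * Rᴴ) := by
    rw [act12_smul, act23_smul, act12_spanProj, act23_spanProj, ← hLdef, ← hRdef, ← hN', ← hN]
    simp only [Matrix.smul_mul, Matrix.mul_smul, smul_smul, Matrix.mul_assoc]
    congr 1; ring
  constructor
  · intro h
    have h12 := h.braid12
    rw [e1, act12_smul, act12_spanProj, ← hLdef] at h12
    have h3 := smul_right_injective _ hQ' h12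
    have h4 := congrArg (fun X => Lᴴ * X * L) h3
    simp only [Matrix.mul_assoc, hL, Matrix.mul_one] at h4
    simp only [← Matrix.mul_assoc, hL, Matrix.one_mul] at h4
    exact h4
  · intro h
    have h' : ((Q : ℂ) ^ 2) • (N * Nᴴ) = 1 := by
      rw [← Matrix.smul_mul] at h
      rw [← Matrix.mul_smul]
      exact mul_eq_one_comm.1 h
    refine ⟨?_, ?_, ?_, ?_⟩
    · rw [Matrix.conjTranspose_smul, spanProj_conjTranspose]
      simp
    · rw [Matrix.smul_mul, Matrix.mul_smul, mul_spanProj v _ (spanProj_mulVec_self hv)]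
    · rw [e1, h, act12_smul, act12_spanProj, Matrix.mul_one]
    · rw [e2, h', act23_smul, act23_spanProj, Matrix.mul_one]

end Criterion

end TLPairs

namespace TLPairs

/-! ### Weight vectors -/

section Coefficients

variable {n : ℕ}

/-- The coefficients of a vector, extended by zero to integer indices. -/
def zext (w : Fin n × Fin n → ℂ) (a b : ℤ) : ℂ :=
  if h : (0 ≤ a ∧ a < n) ∧ (0 ≤ b ∧ b < n) then
    w (⟨a.toNat, by omega⟩, ⟨b.toNat, by omega⟩) else 0

@[simp] lemma zext_coe (w : Fin n × Fin n → ℂ) (a b : Fin n) :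
    zext w (a : ℕ) (b : ℕ) = w (a, b) := by
  have ha := a.isLt
  have hb := b.isLt
  simp [zext]

lemma zext_eq_zero (w : Fin n × Fin n → ℂ) {a b : ℤ}
    (h : ¬ ((0 ≤ a ∧ a < n) ∧ (0 ≤ b ∧ b < n))) : zext w a b = 0 := by
  simp only [zext, dif_neg h]

lemma zext_ext {w w' : Fin n × Fin n → ℂ} :
    w = w' ↔ ∀ a b : ℤ, 0 ≤ a → a < n → 0 ≤ b → b < n → zext w a b = zext w' a b := by
  constructor
  · rintro rfl
    simp
  · intro h
    ext ⟨a, b⟩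
    have := h (a : ℕ) (b : ℕ) (by omega) (by have := a.isLt; omega) (by omega)
      (by have := b.isLt; omega)
    simpa using this

lemma zext_smul (z : ℂ) (w : Fin n × Fin n → ℂ) (a b : ℤ) :
    zext (z • w) a b = z * zext w a b := by
  unfold zext
  split_ifs <;> simp

lemma sum_fin_eq {M : Type*} [AddCommMonoid M] (F : ℤ → M) (t : ℤ)
    (h : ∀ x, x ≠ t → F x = 0) (ht : ¬ (0 ≤ t ∧ t < n) → F t = 0) :
    ∑ a : Fin n, F (a : ℕ) = F t := by
  by_cases h0 : 0 ≤ t ∧ t < n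
  · rw [Finset.sum_eq_single (⟨t.toNat, by omega⟩ : Fin n)]
    · congr 1
      simp [h0.1]
    · intro x _ hx
      apply h
      intro hxt
      apply hx
      ext
      simp only
      omega
    · simp
  · rw [ht h0]
    refine Finset.sum_eq_zero fun x _ => h _ ?_
    have := x.isLt
    omega

/-- The vector `w` is supported on the antidiagonal `a + b = s`. -/
def SuppOn (w : Fin n × Fin n → ℂ) (s : ℤ) : Prop :=
  ∀ a b : ℤ, zext w a b ≠ 0 → a + b = s

/-- The coefficient of `e_{s-c} ⊗ e_c`. -/
def coeff (w : Fin n × Fin n → ℂ) (s c : ℤ) : ℂ := zext w (s - c) c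

/-- The squared modulus of the coefficient of `e_{s-c} ⊗ e_c`. -/
noncomputable def prob (w : Fin n × Fin n → ℂ) (s c : ℤ) : ℝ := Complex.normSq (coeff w s c)

lemma prob_nonneg (w : Fin n × Fin n → ℂ) (s c : ℤ) : 0 ≤ prob w s c := Complex.normSq_nonneg _

lemma coeff_eq_zero (w : Fin n × Fin n → ℂ) {s c : ℤ}
    (h : ¬ ((0 ≤ s - c ∧ s - c < n) ∧ (0 ≤ c ∧ c < n))) : coeff w s c = 0 :=
  zext_eq_zero w h

lemma prob_eq_zero (w : Fin n × Fin n → ℂ) {s c : ℤ}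
    (h : ¬ ((0 ≤ s - c ∧ s - c < n) ∧ (0 ≤ c ∧ c < n))) : prob w s c = 0 := by
  rw [prob, coeff_eq_zero w h, map_zero]

lemma SuppOn.zext_eq_zero {w : Fin n × Fin n → ℂ} {s a b : ℤ} (h : SuppOn w s)
    (hab : a + b ≠ s) : zext w a b = 0 := by
  by_contra h0
  exact hab (h a b h0)

lemma sum_prob {w : Fin n × Fin n → ℂ} {s : ℤ} (hs : SuppOn w s) (hw : star w ⬝ᵥ w = 1) :
    ∑ c : Fin n, prob w s (c : ℕ) = 1 := by
  rw [dotProduct, Fintype.sum_prod_type, Finset.sum_comm] at hw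
  have : ((∑ c : Fin n, prob w s (c : ℕ) : ℝ) : ℂ) = 1 := by
    rw [← hw, Complex.ofReal_sum]
    refine Finset.sum_congr rfl fun c _ => ?_
    have := sum_fin_eq (n := n) (fun x => star (zext w x (c : ℕ)) * zext w x (c : ℕ)) (s - (c : ℕ))
      (fun x hx => by rw [hs.zext_eq_zero (by omega)]; simp)
      (fun h => by rw [zext_eq_zero w (by tauto)]; simp)
    simp only [zext_coe] at this
    simp only [Pi.star_apply]
    rw [this, prob, coeff, Complex.normSq_eq_conj_mul_self]
    rfl
  exact_mod_cast this

lemma overlap_apply_of_suppOn {v : Fin 2 → Fin n × Fin n → ℂ} {s : Fin 2 → ℤ}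
    (hs : ∀ i, SuppOn (v i) (s i)) (j k : Fin 2) (a c : Fin n) :
    overlap v (j, a) (k, c) =
      star (coeff (v j) (s j) (c : ℕ)) * zext (v k) (a : ℕ) (s j - (c : ℕ)) := by
  have := sum_fin_eq (n := n)
    (fun x => star (zext (v j) x (c : ℕ)) * zext (v k) (a : ℕ) x) (s j - (c : ℕ))
    (fun x hx => by rw [(hs j).zext_eq_zero (by omega)]; simp)
    (fun h => by rw [zext_eq_zero (v j) (by tauto)]; simp)
  simp only [zext_coe] at this
  simp only [overlap, Matrix.of_apply]
  rw [this, coeff]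

lemma overlap_gram {v : Fin 2 → Fin n × Fin n → ℂ} {s : Fin 2 → ℤ}
    (hs : ∀ i, SuppOn (v i) (s i)) {i k : Fin 2} (hik : s i = s k) (c : Fin n) :
    ((overlap v)ᴴ * overlap v) (i, c) (k, c) =
      ∑ j, (prob (v j) (s j) (c : ℕ) : ℂ) *
        (star (coeff (v i) (s i) (s j - (c : ℕ))) * coeff (v k) (s k) (s j - (c : ℕ))) := by
  simp only [Matrix.mul_apply, Matrix.conjTranspose_apply, Fintype.sum_prod_type,
    overlap_apply_of_suppOn hs]
  refine Finset.sum_congr rfl fun j _ => ?_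
  have := sum_fin_eq (n := n) (fun x => star (star (coeff (v j) (s j) (c : ℕ)) *
      zext (v i) x (s j - (c : ℕ))) * (star (coeff (v j) (s j) (c : ℕ)) *
      zext (v k) x (s j - (c : ℕ)))) (s k - (s j - (c : ℕ)))
    (fun x hx => by rw [(hs k).zext_eq_zero (by omega)]; simp)
    (fun h => by rw [zext_eq_zero (v k) (by tauto)]; simp)
  rw [this, prob, Complex.normSq_eq_conj_mul_self]
  simp only [coeff, hik, star_mul', star_star, starRingEnd_apply]
  ring

/-- The diagonal entries of the Temperley-Lieb relation. -/
lemma prob_relation {v : Fin 2 → Fin n × Fin n → ℂ} {s : Fin 2 → ℤ}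
    (hs : ∀ i, SuppOn (v i) (s i)) {Q : ℝ}
    (h : ((Q : ℂ) ^ 2) • ((overlap v)ᴴ * overlap v) = 1) (i : Fin 2) {c : ℤ}
    (hc : 0 ≤ c) (hc' : c < n) :
    prob (v 0) (s 0) c * prob (v i) (s i) (s 0 - c) +
      prob (v 1) (s 1) c * prob (v i) (s i) (s 1 - c) = (Q⁻¹) ^ 2 := by
  lift c to ℕ using hc
  have hc2 : c < n := by omega
  have h1 := congrFun (congrFun h (i, ⟨c, hc2⟩)) (i, ⟨c, hc2⟩)
  rw [Matrix.smul_apply, overlap_gram hs rfl] at h1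
  simp only [Fin.sum_univ_two, Matrix.one_apply_eq, smul_eq_mul] at h1
  have e : ∀ z : ℂ, star z * z = (Complex.normSq z : ℂ) := fun z =>
    (Complex.normSq_eq_conj_mul_self).symm
  simp only [e] at h1
  have h2 : Q ^ 2 * (prob (v 0) (s 0) c * prob (v i) (s i) (s 0 - c) +
      prob (v 1) (s 1) c * prob (v i) (s i) (s 1 - c)) = 1 := by
    have : ((Q ^ 2 * (prob (v 0) (s 0) c * prob (v i) (s i) (s 0 - c) +
      prob (v 1) (s 1) c * prob (v i) (s i) (s 1 - c)) : ℝ) : ℂ) = 1 := by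
      rw [← h1]
      simp only [prob]
      push_cast
      rfl
    exact_mod_cast this
  rw [inv_pow]
  exact eq_inv_of_mul_eq_one_right h2

/-- Two vectors of the same weight do not satisfy the Temperley-Lieb relation. -/
lemma weight_ne {v : Fin 2 → Fin n × Fin n → ℂ} {s : Fin 2 → ℤ}
    (hs : ∀ i, SuppOn (v i) (s i)) (hn : 0 < n) {Q : ℝ} (hQ : 0 < Q)
    (h : ((Q : ℂ) ^ 2) • ((overlap v)ᴴ * overlap v) = 1) : s 0 ≠ s 1 := by
  intro hss
  have hκ : 0 < (Q⁻¹) ^ 2 := by positivity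
  have r0 := prob_relation hs h 0 le_rfl (by omega : (0 : ℤ) < n)
  have r1 := prob_relation hs h 1 le_rfl (by omega : (0 : ℤ) < n)
  have h1 := congrFun (congrFun h (0, ⟨0, hn⟩)) (1, ⟨0, hn⟩)
  rw [Matrix.smul_apply, overlap_gram hs hss] at h1
  rw [← hss, ← add_mul] at r0 r1
  simp only [Fin.sum_univ_two, ← hss, ← add_mul, smul_eq_mul, CharP.cast_eq_zero] at h1
  have hsum : prob (v 0) (s 0) 0 + prob (v 1) (s 0) 0 ≠ 0 := by
    intro h0
    rw [h0, zero_mul] at r0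
    exact hκ.ne r0
  have hne : ∀ i : Fin 2, (prob (v 0) (s 0) 0 + prob (v 1) (s 0) 0) *
      prob (v i) (s 0) (s 0 - 0) = Q⁻¹ ^ 2 → coeff (v i) (s 0) (s 0 - 0) ≠ 0 := by
    intro i hi h0
    rw [show prob (v i) (s 0) (s 0 - 0) = 0 by rw [prob, h0, map_zero], mul_zero] at hi
    exact hκ.ne hi
  have hQ' : (Q : ℂ) ≠ 0 := by exact_mod_cast hQ.ne'
  have hsum' : ((prob (v 0) (s 0) 0 : ℂ) + (prob (v 1) (s 0) 0 : ℂ)) ≠ 0 := by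
    exact_mod_cast hsum
  have : ((1 : Matrix (Fin 2 × Fin n) (Fin 2 × Fin n) ℂ) (0, ⟨0, hn⟩) (1, ⟨0, hn⟩)) = 0 := by
    simp
  rw [this] at h1
  exact mul_ne_zero (pow_ne_zero 2 hQ') (mul_ne_zero hsum'
    (mul_ne_zero (star_ne_zero.2 (hne 0 r0)) (hne 1 r1))) h1

end Coefficients

end TLPairs

namespace TLPairs

noncomputable section

/-! ### The vectors `|J,m⟩_q` through the operator `Δ(X⁻) Δ(X⁺)` -/

section Kets

variable {d : ℕ} {q : ℝ}

/-- The weight `S - a`, as a function of an integer. -/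
def wt (d : ℕ) (a : ℤ) : ℝ := (d : ℝ) / 2 - a

/-- The matrix element of `X⁺` from `e_a` to `e_{a-1}`. -/
def ladder (d : ℕ) (q : ℝ) (a : ℤ) : ℝ :=
  Real.sqrt (qNum q a * qNum q (d + 1 - a))

/-- The eigenvalue of `X⁻ X⁺` on `|J,m⟩`. -/
def lowerRaise (q : ℝ) (J : ℕ) (m : ℤ) : ℝ :=
  qNum q J * qNum q (J + 1) - qNum q m * qNum q (m + 1)

lemma qNum_zero (q : ℝ) : qNum q 0 = 0 := by simp [qNum]

lemma ladder_zero (d : ℕ) (q : ℝ) : ladder d q 0 = 0 := by simp [ladder, qNum_zero]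

lemma raise_apply (a b : Fin (d + 1)) :
    raise d q a b = if (b : ℤ) = (a : ℕ) + 1 then (ladder d q (b : ℕ) : ℂ) else 0 := by
  simp only [raise, Matrix.of_apply, ladder, weight]
  have : ((a : ℕ) + 1 = b) ↔ ((b : ℤ) = (a : ℕ) + 1) := by omega
  simp only [this]
  split_ifs
  · congr 4
    · push_cast; ring
    · push_cast; ring
  · rfl

lemma lower_apply (a b : Fin (d + 1)) :
    lower d q a b = if (b : ℤ) = (a : ℕ) - 1 then (ladder d q (a : ℕ) : ℂ) else 0 := by
  rw [lower, Matrix.conjTranspose_apply, raise_apply]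
  have : ((b : ℤ) = (a : ℕ) - 1) ↔ ((a : ℤ) = (b : ℕ) + 1) := by omega
  simp only [this]
  split_ifs <;> simp

lemma deltaX_mulVec (X : Op1 d) (v : Fin (d + 1) × Fin (d + 1) → ℂ) (a b : Fin (d + 1)) :
    (deltaX d q X *ᵥ v) (a, b) =
      (∑ x, X a x * ((q ^ wt d (b : ℕ) : ℝ) : ℂ) * v (x, b)) +
        ∑ x, ((q ^ (-wt d (a : ℕ)) : ℝ) : ℂ) * X b x * v (a, x) := by
  simp only [deltaX, Matrix.mulVec, dotProduct, Matrix.add_apply, Matrix.kroneckerMap_apply,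
    add_mul, Finset.sum_add_distrib, Fintype.sum_prod_type, opK, opKinv, Matrix.diagonal_apply]
  congr 1
  · refine Finset.sum_congr rfl fun x _ => ?_
    rw [Finset.sum_eq_single b]
    · simp [wt, weight]
    · intro y _ hy
      simp [Ne.symm hy]
    · simp
  · rw [Finset.sum_eq_single a]
    · simp [wt, weight]
    · intro y _ hy
      simp [Ne.symm hy]
    · simp

lemma zext_deltaX_raise (v : Fin (d + 1) × Fin (d + 1) → ℂ) {a b : ℤ} (ha : 0 ≤ a)
    (ha' : a ≤ d) (hb : 0 ≤ b) (hb' : b ≤ d) :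
    zext (deltaX d q (raise d q) *ᵥ v) a b =
      ladder d q (a + 1) * ((q ^ wt d b : ℝ) : ℂ) * zext v (a + 1) b +
        ((q ^ (-wt d a) : ℝ) : ℂ) * ladder d q (b + 1) * zext v a (b + 1) := by
  lift a to ℕ using ha
  lift b to ℕ using hb
  have h := zext_coe (deltaX d q (raise d q) *ᵥ v) ⟨a, by omega⟩ ⟨b, by omega⟩
  rw [deltaX_mulVec] at h
  simp only [raise_apply] at h
  rw [h]
  congr 1
  · have := sum_fin_eq (n := d + 1) (fun x => (if x = (a : ℤ) + 1 then
      (ladder d q x : ℂ) else 0) * ((q ^ wt d b : ℝ) : ℂ) * zext v x b) (a + 1)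
      (fun x hx => by simp [hx]) (fun h => by rw [zext_eq_zero v (by push_cast at *; tauto)]; simp)
    simp only [if_true] at this
    rw [← this]
    refine Finset.sum_congr rfl fun x _ => ?_
    rw [← zext_coe v]
  · have := sum_fin_eq (n := d + 1) (fun x => ((q ^ (-wt d a) : ℝ) : ℂ) *
      (if x = (b : ℤ) + 1 then (ladder d q x : ℂ) else 0) * zext v a x) (b + 1)
      (fun x hx => by simp [hx]) (fun h => by rw [zext_eq_zero v (by push_cast at *; tauto)]; simp)
    simp only [if_true] at this
    rw [← this]
    refine Finset.sum_congr rfl fun x _ => ?_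
    rw [← zext_coe v]

lemma zext_deltaX_lower (v : Fin (d + 1) × Fin (d + 1) → ℂ) {a b : ℤ} (ha : 0 ≤ a)
    (ha' : a ≤ d) (hb : 0 ≤ b) (hb' : b ≤ d) :
    zext (deltaX d q (lower d q) *ᵥ v) a b =
      ladder d q a * ((q ^ wt d b : ℝ) : ℂ) * zext v (a - 1) b +
        ((q ^ (-wt d a) : ℝ) : ℂ) * ladder d q b * zext v a (b - 1) := by
  lift a to ℕ using ha
  lift b to ℕ using hb
  have h := zext_coe (deltaX d q (lower d q) *ᵥ v) ⟨a, by omega⟩ ⟨b, by omega⟩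
  rw [deltaX_mulVec] at h
  simp only [lower_apply] at h
  rw [h]
  congr 1
  · have := sum_fin_eq (n := d + 1) (fun x => (if x = (a : ℤ) - 1 then
      (ladder d q a : ℂ) else 0) * ((q ^ wt d b : ℝ) : ℂ) * zext v x b) (a - 1)
      (fun x hx => by simp [hx]) (fun h => by rw [zext_eq_zero v (by push_cast at *; tauto)]; simp)
    simp only [if_true] at this
    rw [← this]
    refine Finset.sum_congr rfl fun x _ => ?_
    rw [← zext_coe v]
  · have := sum_fin_eq (n := d + 1) (fun x => ((q ^ (-wt d a) : ℝ) : ℂ) *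
      (if x = (b : ℤ) - 1 then (ladder d q b : ℂ) else 0) * zext v a x) (b - 1)
      (fun x hx => by simp [hx]) (fun h => by rw [zext_eq_zero v (by push_cast at *; tauto)]; simp)
    simp only [if_true] at this
    rw [← this]
    refine Finset.sum_congr rfl fun x _ => ?_
    rw [← zext_coe v]

lemma zext_lower_raise (v : Fin (d + 1) × Fin (d + 1) → ℂ) {a b : ℤ} (ha : 0 ≤ a)
    (ha' : a ≤ d) (hb : 0 ≤ b) (hb' : b ≤ d) :
    zext (deltaX d q (lower d q) *ᵥ (deltaX d q (raise d q) *ᵥ v)) a b =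
      ladder d q a * ((q ^ wt d b : ℝ) : ℂ) *
          (ladder d q a * ((q ^ wt d b : ℝ) : ℂ) * zext v a b +
            ((q ^ (-wt d (a - 1)) : ℝ) : ℂ) * ladder d q (b + 1) * zext v (a - 1) (b + 1)) +
        ((q ^ (-wt d a) : ℝ) : ℂ) * ladder d q b *
          (ladder d q (a + 1) * ((q ^ wt d (b - 1) : ℝ) : ℂ) * zext v (a + 1) (b - 1) +
            ((q ^ (-wt d a) : ℝ) : ℂ) * ladder d q b * zext v a b) := by
  rw [zext_deltaX_lower _ ha ha' hb hb']
  congr 1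
  · rcases ha.eq_or_lt with rfl | h
    · simp [ladder_zero]
    · rw [zext_deltaX_raise _ (by omega) (by omega) hb hb', sub_add_cancel]
  · rcases hb.eq_or_lt with rfl | h
    · simp [ladder_zero]
    · rw [zext_deltaX_raise _ ha ha' (by omega) (by omega), sub_add_cancel]

lemma deltaH_mulVec (v : Fin (d + 1) × Fin (d + 1) → ℂ) (x : Fin (d + 1) × Fin (d + 1)) :
    (deltaH d *ᵥ v) x = ((weight d x.1 + weight d x.2 : ℝ) : ℂ) * v x := by
  have : deltaH d = Matrix.diagonal fun x : Fin (d + 1) × Fin (d + 1) =>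
      ((weight d x.1 + weight d x.2 : ℝ) : ℂ) := by
    rw [deltaH, opH, ← Matrix.diagonal_one, Matrix.diagonal_kronecker_diagonal,
      Matrix.diagonal_kronecker_diagonal, Matrix.diagonal_add]
    simp
  rw [this, Matrix.mulVec_diagonal]

lemma deltaK_mulVec (hq : 0 < q) (v : Fin (d + 1) × Fin (d + 1) → ℂ)
    (x : Fin (d + 1) × Fin (d + 1)) :
    (deltaK d q *ᵥ v) x = ((q ^ (weight d x.1 + weight d x.2) : ℝ) : ℂ) * v x := by
  have : deltaK d q = Matrix.diagonal fun x : Fin (d + 1) × Fin (d + 1) =>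
      ((q ^ (weight d x.1 + weight d x.2) : ℝ) : ℂ) := by
    rw [deltaK, opK, Matrix.diagonal_kronecker_diagonal]
    simp [Real.rpow_add hq]
  rw [this, Matrix.mulVec_diagonal]

lemma deltaKinv_mulVec (hq : 0 < q) (v : Fin (d + 1) × Fin (d + 1) → ℂ)
    (x : Fin (d + 1) × Fin (d + 1)) :
    (deltaKinv d q *ᵥ v) x = ((q ^ (-(weight d x.1 + weight d x.2)) : ℝ) : ℂ) * v x := by
  have : deltaKinv d q = Matrix.diagonal fun x : Fin (d + 1) × Fin (d + 1) =>
      ((q ^ (-(weight d x.1 + weight d x.2)) : ℝ) : ℂ) := by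
    rw [deltaKinv, opKinv, Matrix.diagonal_kronecker_diagonal]
    simp [Real.rpow_add hq, mul_comm]
  rw [this, Matrix.mulVec_diagonal]

lemma suppOn_iff (m : ℤ) (v : Fin (d + 1) × Fin (d + 1) → ℂ) :
    SuppOn v (d - m) ↔ ∀ x, v x ≠ 0 → weight d x.1 + weight d x.2 = m := by
  constructor
  · rintro h ⟨a, b⟩ hx
    have h1 := h (a : ℕ) (b : ℕ) (by rwa [zext_coe])
    have h2 : ((a : ℕ) : ℝ) + ((b : ℕ) : ℝ) = d - m := by exact_mod_cast h1
    simp only [weight]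
    linarith
  · intro h a b hab
    by_cases hr : (0 ≤ a ∧ a < (d + 1 : ℕ)) ∧ (0 ≤ b ∧ b < (d + 1 : ℕ))
    · obtain ⟨⟨h1, h2⟩, h3, h4⟩ := hr
      lift a to ℕ using h1
      lift b to ℕ using h3
      have h5 := zext_coe v ⟨a, by omega⟩ ⟨b, by omega⟩
      simp only at h5
      rw [h5] at hab
      have h6 := h _ hab
      simp only [weight] at h6
      have h7 : ((a : ℕ) : ℝ) + ((b : ℕ) : ℝ) = d - m := by linarith
      exact_mod_cast h7
    · exact absurd (zext_eq_zero v hr) hab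

lemma deltaH_mulVec_iff (m : ℤ) (v : Fin (d + 1) × Fin (d + 1) → ℂ) :
    deltaH d *ᵥ v = (m : ℂ) • v ↔ SuppOn v (d - m) := by
  rw [suppOn_iff, funext_iff]
  refine forall_congr' fun x => ?_
  rw [deltaH_mulVec, Pi.smul_apply, smul_eq_mul, mul_eq_mul_right_iff]
  have : (((weight d x.1 + weight d x.2 : ℝ) : ℂ) = (m : ℂ)) ↔
      weight d x.1 + weight d x.2 = m := by
    rw [← Complex.ofReal_intCast, Complex.ofReal_inj]
  rw [this]
  tauto

lemma deltaK_mulVec_iff (hq : 0 < q) (hq1 : q ≠ 1) (m : ℤ)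
    (v : Fin (d + 1) × Fin (d + 1) → ℂ) :
    deltaK d q *ᵥ v = ((q ^ m : ℝ) : ℂ) • v ↔ SuppOn v (d - m) := by
  rw [suppOn_iff, funext_iff]
  refine forall_congr' fun x => ?_
  rw [deltaK_mulVec hq, Pi.smul_apply, smul_eq_mul, mul_eq_mul_right_iff, Complex.ofReal_inj,
    ← Real.rpow_intCast, Real.rpow_right_inj hq hq1]
  tauto

lemma deltaCasimirOne_mulVec {m : ℤ} {v : Fin (d + 1) × Fin (d + 1) → ℂ}
    (hv : SuppOn v (d - m)) :
    deltaCasimirOne d *ᵥ v =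
      deltaX d 1 (lower d 1) *ᵥ (deltaX d 1 (raise d 1) *ᵥ v) + ((m : ℂ) * (m + 1)) • v := by
  have h := (deltaH_mulVec_iff m v).2 hv
  rw [deltaCasimirOne, Matrix.add_mulVec, ← Matrix.mulVec_mulVec, ← Matrix.mulVec_mulVec,
    Matrix.add_mulVec, h, Matrix.one_mulVec, Matrix.mulVec_add, Matrix.mulVec_smul, h]
  congr 1
  module

lemma deltaCasimir_mulVec (hq : 0 < q) (hq1 : q ≠ 1) {m : ℤ}
    {v : Fin (d + 1) × Fin (d + 1) → ℂ} (hv : SuppOn v (d - m)) :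
    deltaCasimir d q *ᵥ v =
      deltaX d q (lower d q) *ᵥ (deltaX d q (raise d q) *ᵥ v) +
        ((qNum q m * qNum q (m + 1) : ℝ) : ℂ) • v := by
  have h := (deltaK_mulVec_iff hq hq1 m v).2 hv
  have h' : deltaKinv d q *ᵥ v = ((q ^ (-m) : ℝ) : ℂ) • v := by
    rw [suppOn_iff] at hv
    ext x
    rw [deltaKinv_mulVec hq, Pi.smul_apply, smul_eq_mul]
    by_cases hx : v x = 0
    · simp [hx]
    · rw [hv x hx, ← Real.rpow_intCast]
      push_cast
      rfl
  rw [deltaCasimir, Matrix.add_mulVec, ← Matrix.mulVec_mulVec, Matrix.smul_mulVec,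
    ← Matrix.mulVec_mulVec]
  simp only [Matrix.sub_mulVec, Matrix.smul_mulVec, h, h', Matrix.mulVec_sub,
    Matrix.mulVec_smul]
  congr 1
  have hqq : q - q⁻¹ ≠ 0 := by
    intro h0
    field_simp at h0
    apply hq1
    nlinarith
  have e : qNum q m * qNum q (m + 1) =
      ((q - q⁻¹) ^ 2)⁻¹ * ((q ^ m - q ^ (-m)) * (q * q ^ m - q⁻¹ * q ^ (-m))) := by
    have e1 : q ^ ((m : ℝ) + 1) = q * q ^ m := by
      rw [Real.rpow_add hq, Real.rpow_one, Real.rpow_intCast, mul_comm]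
    have e2 : q ^ (-((m : ℝ) + 1)) = q⁻¹ * q ^ (-m) := by
      rw [Real.rpow_neg hq.le, e1, mul_inv, zpow_neg]
    have e3 : q ^ (-(m : ℝ)) = q ^ (-m) := by
      rw [← Real.rpow_intCast]; push_cast; rfl
    rw [qNum, qNum, if_neg hq1, if_neg hq1, e1, e2, e3, Real.rpow_intCast]
    field_simp
  rw [e]
  push_cast
  module

/-- The joint eigenvector equations, for all `q > 0` at once. -/
lemma isKet_iff (hq : 0 < q) {J : ℕ} {m : ℤ} {v : Fin (d + 1) × Fin (d + 1) → ℂ} :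
    IsKet d q J m v ↔ J ≤ d ∧ |m| ≤ (J : ℤ) ∧ star v ⬝ᵥ v = 1 ∧ SuppOn v (d - m) ∧
      deltaX d q (lower d q) *ᵥ (deltaX d q (raise d q) *ᵥ v) =
        ((lowerRaise q J m : ℝ) : ℂ) • v := by
  rw [IsKet]
  refine and_congr_right fun _ => and_congr_right fun _ => and_congr_right fun _ => ?_
  by_cases hq1 : q = 1
  · subst hq1
    simp only [ne_eq, not_true_eq_false, false_imp_iff, and_true, true_imp_iff]
    rw [deltaH_mulVec_iff]
    refine and_congr_right fun hv => ?_
    rw [deltaCasimirOne_mulVec hv, ← eq_sub_iff_add_eq, ← sub_smul]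
    simp [lowerRaise, qNum]
  · simp only [hq1, false_imp_iff, true_and, ne_eq, not_false_eq_true, true_imp_iff]
    rw [deltaK_mulVec_iff hq hq1]
    refine and_congr_right fun hv => ?_
    rw [deltaCasimir_mulVec hq hq1 hv, ← eq_sub_iff_add_eq, ← sub_smul, lowerRaise]
    push_cast
    rfl

end Kets

end

end TLPairs

namespace TLPairs

noncomputable section

/-! ### Coefficient sequences at `q = 1` -/

section Chains

variable {d J : ℕ} {m : ℤ}

/-- The square root of `a (d + 1 - a)`. -/
def root (d : ℕ) (a : ℤ) : ℝ := Real.sqrt (a * (d + 1 - a))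

/-- The three-term recurrence of the coefficients of `|J,m⟩₁`. -/
structure IsChain (d J : ℕ) (m : ℤ) (g : ℤ → ℂ) : Prop where
  supp : ∀ c, g c ≠ 0 → (0 ≤ c ∧ c ≤ d) ∧ (0 ≤ d - m - c ∧ d - m - c ≤ d)
  step : ∀ c : ℤ, 0 ≤ c → c ≤ d → 0 ≤ d - m - c → d - m - c ≤ d →
    ((root d (d - m - c) * root d (c + 1) : ℝ) : ℂ) * g (c + 1) +
      ((root d c * root d (d - m - c + 1) : ℝ) : ℂ) * g (c - 1) =
    (((J : ℝ) * (J + 1) - m * (m + 1) - ((d - m - c : ℤ) * (d + 1 - (d - m - c : ℤ)) +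
      c * (d + 1 - c)) : ℝ) : ℂ) * g c

lemma root_reflect (d : ℕ) (a b : ℤ) (h : a + b = d + 1) : root d a = root d b := by
  have : (a : ℝ) + b = d + 1 := by exact_mod_cast h
  rw [root, root]
  congr 1
  rw [show (a : ℝ) = d + 1 - b by linarith]
  ring

lemma root_sq (d : ℕ) {a : ℤ} (h : 0 ≤ a) (h' : a ≤ d + 1) : root d a ^ 2 = a * (d + 1 - a) := by
  have h1 : (0 : ℝ) ≤ a := by exact_mod_cast h
  have h2 : (a : ℝ) ≤ d + 1 := by exact_mod_cast h'
  exact Real.sq_sqrt (mul_nonneg h1 (by linarith))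

lemma root_pos (d : ℕ) {a : ℤ} (h : 0 < a) (h' : a ≤ d) : 0 < root d a := by
  have h1 : (0 : ℝ) < a := by exact_mod_cast h
  have h2 : (a : ℝ) ≤ d := by exact_mod_cast h'
  exact Real.sqrt_pos.2 (mul_pos h1 (by linarith))

lemma root_top (d : ℕ) : root d (d + 1) = 0 := by simp [root]

lemma IsChain.swap {g : ℤ → ℂ} (h : IsChain d J m g) :
    IsChain d J m fun c => g (d - m - c) where
  supp c hc := by
    have := h.supp _ hc
    omega
  step c h1 h2 h3 h4 := by
    have := h.step (d - m - c) h3 h4 (by omega) (by omega)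
    rw [show (d : ℤ) - m - (d - m - c) = c by ring] at this
    rw [show (d : ℤ) - m - (c + 1) = d - m - c - 1 by ring,
      show (d : ℤ) - m - (c - 1) = d - m - c + 1 by ring, add_comm, mul_comm (root d c),
      mul_comm (root d (d - m - c))]
    rw [mul_comm (root d c), mul_comm (root d (d - m - c))] at this
    rw [this]
    congr 2
    ring

lemma IsChain.flip {g : ℤ → ℂ} (h : IsChain d J m g) :
    IsChain d J (-m) fun c => g (d - c) where
  supp c hc := by
    have := h.supp _ hc
    omega
  step c h1 h2 h3 h4 := by
    have := h.step (d - c) (by omega) (by omega) (by omega) (by omega)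
    rw [show (d : ℤ) - (c + 1) = d - c - 1 by ring,
      show (d : ℤ) - (c - 1) = d - c + 1 by ring, add_comm,
      root_reflect d c (d - c + 1) (by ring), root_reflect d (c + 1) (d - c) (by ring),
      root_reflect d (d - -m - c) (d - m - (d - c) + 1) (by ring),
      root_reflect d (d - -m - c + 1) (d - m - (d - c)) (by ring),
      mul_comm (root d (d - c + 1)), mul_comm (root d (d - m - (d - c) + 1)), this]
    congr 2
    push_cast
    ring

lemma IsChain.comb {g g' : ℤ → ℂ} (h : IsChain d J m g) (h' : IsChain d J m g') (x y : ℂ) :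
    IsChain d J m fun c => x * g c - y * g' c where
  supp c hc := by
    by_cases h0 : g c = 0
    · refine h'.supp c fun h1 => hc ?_
      simp [h0, h1]
    · exact h.supp c h0
  step c h1 h2 h3 h4 := by
    have e1 := h.step c h1 h2 h3 h4
    have e2 := h'.step c h1 h2 h3 h4
    linear_combination x * e1 - y * e2

lemma IsChain.eq_zero {g : ℤ → ℂ} (h : IsChain d J m g) (hm : m ≤ 0) (h0 : g d = 0) :
    g = 0 := by
  have key : ∀ k : ℕ, g (d - k) = 0 ∧ g (d - k + 1) = 0 := by
    intro k
    induction k with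
    | zero =>
      refine ⟨by simpa using h0, ?_⟩
      by_contra hne
      have := h.supp _ hne
      push_cast at this
      omega
    | succ k ih =>
      rw [show (d : ℤ) - (k + 1 : ℕ) = d - k - 1 by push_cast; ring]
      refine ⟨?_, by rw [sub_add_cancel]; exact ih.1⟩
      by_contra hne
      have hs := h.supp _ hne
      have e := h.step (d - k) (by omega) (by omega) (by omega) (by omega)
      rw [ih.1, ih.2, mul_zero, mul_zero, zero_add, mul_eq_zero] at e
      rcases e with e | e
      · have h1 := root_pos d (a := d - k) (by omega) (by omega)
        have h2 := root_pos d (a := d - m - (d - k) + 1) (by omega) (by omega)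
        exact (mul_pos h1 h2).ne' (by exact_mod_cast e)
      · exact hne e
  funext c
  by_contra hne
  have hs := h.supp _ hne
  have := (key (d - c).toNat).1
  rw [Int.toNat_of_nonneg (by omega), sub_sub_cancel] at this
  exact hne this

lemma IsChain.normSq_swap_of_nonpos {g : ℤ → ℂ} (h : IsChain d J m g) (hm : m ≤ 0) (c : ℤ) :
    Complex.normSq (g (d - m - c)) = Complex.normSq (g c) := by
  have h0 : (fun c => g d * g (d - m - c) - g (d - m - d) * g c) = 0 :=
    (h.swap.comb h (g d) (g (d - m - d))).eq_zero hm (by ring)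
  by_cases hg : g d = 0
  · rw [h.eq_zero hm hg]
    rfl
  · have e : ∀ c, g d * g (d - m - c) = g (d - m - d) * g c := fun c =>
      sub_eq_zero.1 (congrFun h0 c)
    have e1 := e (d - m - d)
    rw [sub_sub_cancel] at e1
    have n1 := congrArg Complex.normSq e1
    have n2 := congrArg Complex.normSq (e c)
    rw [map_mul, map_mul] at n1 n2
    have hpos := Complex.normSq_pos.2 hg
    have n3 : Complex.normSq (g d) = Complex.normSq (g (d - m - d)) := by
      have := Complex.normSq_nonneg (g (d - m - d))
      nlinarith
    rw [← n3] at n2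
    exact mul_left_cancel₀ hpos.ne' n2

lemma IsChain.normSq_swap {g : ℤ → ℂ} (h : IsChain d J m g) (c : ℤ) :
    Complex.normSq (g (d - m - c)) = Complex.normSq (g c) := by
  rcases le_total m 0 with hm | hm
  · exact h.normSq_swap_of_nonpos hm c
  · have := h.flip.normSq_swap_of_nonpos (by omega) (d - c)
    rw [sub_sub_cancel] at this
    rw [← this]
    congr 2
    ring

/-- If the last two coefficients have equal moduli, the recurrence at the upper end of the
support gives the first ratio of coefficients. -/
lemma IsChain.top_relations {g : ℤ → ℂ} (h : IsChain d J m g) (h0 : g d ≠ 0)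
    (h01 : Complex.normSq (g (d - 1)) = Complex.normSq (g d)) :
    ∃ x y : ℝ, x ≠ 0 ∧ m ≤ 0 ∧ 1 - m ≤ d ∧ y - x = 2 * (-m - d + 1) ∧
      ((x * (y - x) : ℝ) : ℂ) * g d =
        ((root d 1 * root d (1 - m) : ℝ) : ℂ) * ((root d (d - 1) * root d (2 - m) : ℝ) : ℂ) *
          g (d - 2) ∧ (root d 1 * root d (1 - m)) ^ 2 = x ^ 2 := by
  have h1 : g (d - 1) ≠ 0 := by
    rw [← Complex.normSq_pos, h01]
    exact Complex.normSq_pos.2 h0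
  have s0 := h.supp _ h0
  have s1 := h.supp _ h1
  have e0 := h.step d (by omega) le_rfl (by omega) (by omega)
  have e1 := h.step (d - 1) (by omega) (by omega) (by omega) (by omega)
  rw [show (d : ℤ) - m - (d - 1) + 1 = 2 - m by ring, show (d : ℤ) - m - (d - 1) = 1 - m by ring,
    show (d : ℤ) - 1 + 1 = d by ring, show (d : ℤ) - 1 - 1 = d - 2 by ring,
    root_reflect d d 1 (by ring)] at e1
  rw [show (d : ℤ) - m - d + 1 = 1 - m by ring, show (d : ℤ) - m - d = - m by ring,
    root_top, root_reflect d d 1 (by ring), mul_zero, Complex.ofReal_zero, zero_mul,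
    zero_add] at e0
  set x : ℝ := (J : ℝ) * (J + 1) - m * (m + 1) -
    ((-m : ℤ) * (d + 1 - (-m : ℤ)) + (d : ℤ) * (d + 1 - (d : ℤ))) with hx
  set y : ℝ := (J : ℝ) * (J + 1) - m * (m + 1) -
    ((1 - m : ℤ) * (d + 1 - (1 - m : ℤ)) + (d - 1 : ℤ) * (d + 1 - (d - 1 : ℤ))) with hy
  have hpos : 0 < root d 1 * root d (1 - m) :=
    mul_pos (root_pos d (by omega) (by omega)) (root_pos d (by omega) (by omega))
  have hsq : (root d 1 * root d (1 - m)) ^ 2 = x ^ 2 := by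
    have := congrArg Complex.normSq e0
    rw [map_mul, map_mul, h01, Complex.normSq_ofReal, Complex.normSq_ofReal] at this
    have h2 := mul_right_cancel₀ (Complex.normSq_pos.2 h0).ne' this
    linarith
  refine ⟨x, y, ?_, by omega, by omega, ?_, ?_, hsq⟩
  · intro h2
    rw [h2] at hsq
    exact (pow_pos hpos 2).ne' (by simpa using hsq)
  · rw [hx, hy]
    push_cast
    ring
  · have hsq' : (((root d 1 * root d (1 - m)) : ℝ) : ℂ) ^ 2 = (x : ℂ) ^ 2 := by
      exact_mod_cast hsq
    rw [mul_comm (root d (1 - m))] at e1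
    push_cast at e0 e1 hsq' ⊢
    linear_combination (y : ℂ) * (-1) * e0 - (root d 1 * root d (1 - m) : ℂ) * e1 +
      g d * hsq'

lemma IsChain.top_two {g : ℤ → ℂ} (h : IsChain d J m g) (h0 : g d ≠ 0)
    (h01 : Complex.normSq (g (d - 1)) = Complex.normSq (g d)) (h2 : g (d - 2) = 0) :
    (d : ℤ) = 1 - m := by
  obtain ⟨x, y, hx, -, -, hxy, e, -⟩ := h.top_relations h0 h01
  rw [h2, mul_zero, mul_eq_zero, or_iff_left h0, Complex.ofReal_eq_zero, mul_eq_zero,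
    or_iff_right hx, hxy] at e
  have : (d : ℝ) = 1 - m := by linarith
  exact_mod_cast this

lemma IsChain.top_three {g : ℤ → ℂ} (h : IsChain d J m g) (h0 : g d ≠ 0)
    (h01 : Complex.normSq (g (d - 1)) = Complex.normSq (g d))
    (h02 : Complex.normSq (g (d - 2)) = Complex.normSq (g d)) : m = 0 := by
  obtain ⟨x, y, hx, hm, hmd, hxy, e, hsq⟩ := h.top_relations h0 h01
  have h2 : g (d - 2) ≠ 0 := by
    rw [← Complex.normSq_pos, h02]
    exact Complex.normSq_pos.2 h0
  have s2 := h.supp _ h2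
  have n := congrArg Complex.normSq e
  rw [map_mul, map_mul, map_mul, h02, Complex.normSq_ofReal, Complex.normSq_ofReal,
    Complex.normSq_ofReal] at n
  have n2 := mul_right_cancel₀ (Complex.normSq_pos.2 h0).ne' n
  have r1 := root_sq d (a := d - 1) (by omega) (by omega)
  have r2 := root_sq d (a := 2 - m) (by omega) (by omega)
  have n3 : x ^ 2 * (y - x) ^ 2 = x ^ 2 * (root d (d - 1) ^ 2 * root d (2 - m) ^ 2) := by
    linear_combination n2 + root d (d - 1) ^ 2 * root d (2 - m) ^ 2 * hsq
  have n4 := mul_left_cancel₀ (pow_ne_zero 2 hx) n3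
  rw [r1, r2, hxy] at n4
  have hd : (0 : ℝ) ≤ d + m - 2 := by
    have : 0 ≤ (d : ℤ) + m - 2 := by omega
    exact_mod_cast this
  push_cast at n4
  have n5 : ((d : ℝ) + m - 1) * (m * (d + 1)) = 0 := by linear_combination n4 / 2
  rcases mul_eq_zero.1 n5 with h6 | h6
  · linarith
  · rcases mul_eq_zero.1 h6 with h7 | h7
    · exact_mod_cast h7
    · have : (0 : ℝ) ≤ d := by positivity
      linarith

end Chains

end

end TLPairs

namespace TLPairs

noncomputable section

/-! ### Classification at `q = 1` -/

section Classification

/-- The Temperley-Lieb relations for the moduli of the coefficients of two weight vectors, the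
first of the lower weight. -/
structure IsModuliPair (d : ℕ) (s₁ s₂ : ℤ) (κ : ℝ) (p₁ p₂ : ℤ → ℝ) : Prop where
  pos : 0 < κ
  lt : s₂ < s₁
  nonneg₁ : ∀ c, 0 ≤ p₁ c
  nonneg₂ : ∀ c, 0 ≤ p₂ c
  supp₁ : ∀ c, p₁ c ≠ 0 → (0 ≤ c ∧ c ≤ d) ∧ (0 ≤ s₁ - c ∧ s₁ - c ≤ d)
  supp₂ : ∀ c, p₂ c ≠ 0 → (0 ≤ c ∧ c ≤ d) ∧ (0 ≤ s₂ - c ∧ s₂ - c ≤ d)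
  symm₁ : ∀ c, p₁ (s₁ - c) = p₁ c
  symm₂ : ∀ c, p₂ (s₂ - c) = p₂ c
  rel₁ : ∀ c : ℤ, 0 ≤ c → c ≤ d → p₁ c * p₁ (s₁ - c) + p₂ c * p₁ (s₂ - c) = κ ^ 2
  rel₂ : ∀ c : ℤ, 0 ≤ c → c ≤ d → p₁ c * p₂ (s₁ - c) + p₂ c * p₂ (s₂ - c) = κ ^ 2

namespace IsModuliPair

variable {d : ℕ} {s₁ s₂ : ℤ} {κ : ℝ} {p₁ p₂ : ℤ → ℝ}

lemma rel₁' (h : IsModuliPair d s₁ s₂ κ p₁ p₂) {c : ℤ} (h0 : 0 ≤ c) (hd : c ≤ d) :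
    p₁ c ^ 2 + p₂ c * p₁ (c + (s₁ - s₂)) = κ ^ 2 := by
  have e := h.rel₁ c h0 hd
  rw [h.symm₁, ← h.symm₁ (s₂ - c), show s₁ - (s₂ - c) = c + (s₁ - s₂) by ring] at e
  linarith

lemma rel₂' (h : IsModuliPair d s₁ s₂ κ p₁ p₂) {c : ℤ} (h0 : 0 ≤ c) (hd : c ≤ d) :
    p₂ c ^ 2 + p₁ c * p₂ (c - (s₁ - s₂)) = κ ^ 2 := by
  have e := h.rel₂ c h0 hd
  rw [h.symm₂, ← h.symm₂ (s₁ - c), show s₂ - (s₁ - c) = c - (s₁ - s₂) by ring] at e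
  linarith

lemma zero₁ (h : IsModuliPair d s₁ s₂ κ p₁ p₂) {c : ℤ}
    (hc : ¬ ((0 ≤ c ∧ c ≤ d) ∧ (0 ≤ s₁ - c ∧ s₁ - c ≤ d))) : p₁ c = 0 := by
  by_contra h0
  exact hc (h.supp₁ c h0)

lemma zero₂ (h : IsModuliPair d s₁ s₂ κ p₁ p₂) {c : ℤ}
    (hc : ¬ ((0 ≤ c ∧ c ≤ d) ∧ (0 ≤ s₂ - c ∧ s₂ - c ≤ d))) : p₂ c = 0 := by
  by_contra h0
  exact hc (h.supp₂ c h0)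

lemma eq₁ (h : IsModuliPair d s₁ s₂ κ p₁ p₂) {c : ℤ} (h0 : 0 ≤ c) (hd : c ≤ d)
    (h1 : p₂ c = 0 ∨ p₁ (c + (s₁ - s₂)) = 0) : p₁ c = κ := by
  have e := h.rel₁' h0 hd
  rw [mul_eq_zero.2 h1, add_zero] at e
  exact (pow_left_inj₀ (h.nonneg₁ c) h.pos.le two_ne_zero).1 e

lemma eq₂ (h : IsModuliPair d s₁ s₂ κ p₁ p₂) {c : ℤ} (h0 : 0 ≤ c) (hd : c ≤ d)
    (h1 : p₁ c = 0 ∨ p₂ (c - (s₁ - s₂)) = 0) : p₂ c = κ := by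
  have e := h.rel₂' h0 hd
  rw [mul_eq_zero.2 h1, add_zero] at e
  exact (pow_left_inj₀ (h.nonneg₂ c) h.pos.le two_ne_zero).1 e

lemma top (h : IsModuliPair d s₁ s₂ κ p₁ p₂) {c : ℤ} (h0 : 0 ≤ c) (hd : c ≤ d)
    (h1 : d < c + (s₁ - s₂)) : p₁ c = κ :=
  h.eq₁ h0 hd (Or.inr (h.zero₁ (by omega)))

lemma bot (h : IsModuliPair d s₁ s₂ κ p₁ p₂) {c : ℤ} (h0 : 0 ≤ c) (hd : c ≤ d)
    (h1 : c < s₁ - s₂) : p₂ c = κ :=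
  h.eq₂ h0 hd (Or.inr (h.zero₂ (by omega)))

lemma shift (h : IsModuliPair d s₁ s₂ κ p₁ p₂) {c c' : ℤ} (h0 : 0 ≤ c) (hd : c' ≤ d)
    (hc : c' = c + (s₁ - s₂)) : p₂ c' = p₁ c := by
  subst hc
  have hlt := h.lt
  have e1 := h.rel₁' h0 (by omega)
  have e2 := h.rel₂' (c := c + (s₁ - s₂)) (by omega) hd
  rw [add_sub_cancel_right] at e2
  refine (pow_left_inj₀ (h.nonneg₂ _) (h.nonneg₁ c) two_ne_zero).1 ?_
  linarith

lemma classification (h : IsModuliPair d s₁ s₂ κ p₁ p₂)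
    (two₁ : p₁ d = κ → p₁ (d - 1) = κ → p₁ (d - 2) = 0 → s₁ = 2 * d - 1)
    (three₁ : p₁ d = κ → p₁ (d - 1) = κ → p₁ (d - 2) = κ → s₁ = d)
    (two₂ : p₂ 0 = κ → p₂ 1 = κ → p₂ 2 = 0 → s₂ = 1)
    (three₂ : p₂ 0 = κ → p₂ 1 = κ → p₂ 2 = κ → s₂ = d) :
    d = 2 ∧ ((s₁ = 3 ∧ s₂ = 1) ∨ (s₁ = 3 ∧ s₂ = 2 ∧ p₂ 1 = 0) ∨
      (s₁ = 2 ∧ s₂ = 1 ∧ p₁ 1 = 0)) ∧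
      (s₁ = 3 → p₁ 1 = κ ∧ p₁ 2 = κ) ∧ (s₂ = 1 → p₂ 0 = κ ∧ p₂ 1 = κ) := by
  have hlt := h.lt
  have hκ := h.pos
  have t0 : p₁ d = κ := h.top (by omega) le_rfl (by omega)
  have b0 : p₂ 0 = κ := h.bot le_rfl (by omega) (by omega)
  have st := h.supp₁ d (by rw [t0]; exact hκ.ne')
  have sb := h.supp₂ 0 (by rw [b0]; exact hκ.ne')
  have hδ : s₁ - s₂ ≤ d := by
    by_contra hc
    have h1 := h.supp₁ 0 (by rw [h.top le_rfl (by omega) (by omega)]; exact hκ.ne')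
    have h2 := h.supp₂ d (by rw [h.bot (by omega) le_rfl (by omega)]; exact hκ.ne')
    omega
  by_cases h3 : 3 ≤ s₁ - s₂
  · have := three₁ t0 (h.top (by omega) (by omega) (by omega))
      (h.top (by omega) (by omega) (by omega))
    have := three₂ b0 (h.bot (by omega) (by omega) (by omega))
      (h.bot (by omega) (by omega) (by omega))
    omega
  by_cases h2 : s₁ - s₂ = 2
  · have t1 : p₁ (d - 1) = κ := h.top (by omega) (by omega) (by omega)
    have b1 : p₂ 1 = κ := h.bot (by omega) (by omega) (by omega)
    by_cases hν : s₂ = d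
    · have : p₂ 2 = 0 := by
        rw [h.shift (c := 0) le_rfl (by omega) (by omega), h.zero₁ (by omega)]
      have := two₂ b0 b1 this
      omega
    · have : p₁ (d - 2) = 0 := by
        rw [← h.shift (c := d - 2) (c' := d) (by omega) le_rfl (by omega), h.zero₂ (by omega)]
      have := two₁ t0 t1 this
      have hd : (d : ℤ) = 2 := by
        by_contra hd
        by_cases hμ : s₁ = d
        · omega
        · have : p₂ 2 = 0 := by
            rw [h.shift (c := 0) le_rfl (by omega) (by omega), h.zero₁ (by omega)]
          have := two₂ b0 b1 this
          omega
      rw [hd] at t0 t1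
      exact ⟨by omega, Or.inl (by omega), fun _ => ⟨t1, t0⟩, fun _ => ⟨b0, b1⟩⟩
  have h1 : s₁ = s₂ + 1 := by omega
  by_cases hν : s₂ = d
  · have b1 : p₂ 1 = 0 := by
      rw [h.shift (c := 0) le_rfl (by omega) (by omega), h.zero₁ (by omega)]
    have hd1 : (d : ℤ) ≠ 1 := by
      intro hd
      have := h.symm₂ 0
      rw [show s₂ - 0 = 1 by omega, b0, b1] at this
      exact hκ.ne this
    have b2 : p₂ (d - 1) = 0 := by rw [← hν, h.symm₂, b1]
    have t2 : p₁ (d - 2) = 0 := by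
      rw [← h.shift (c := d - 2) (c' := d - 1) (by omega) (by omega) (by omega), b2]
    have t1 : p₁ (d - 1) = κ := h.eq₁ (by omega) (by omega) (Or.inl b2)
    have := two₁ t0 t1 t2
    have hd : (d : ℤ) = 2 := by omega
    rw [hd] at t0 t1
    exact ⟨by omega, Or.inr (Or.inl ⟨by omega, by omega, b1⟩), fun _ => ⟨t1, t0⟩,
      fun _ => by omega⟩
  · have t1 : p₁ (d - 1) = 0 := by
      rw [← h.shift (c := d - 1) (c' := d) (by omega) le_rfl (by omega), h.zero₂ (by omega)]
    have hd1 : (d : ℤ) ≠ 1 := by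
      intro hd
      have := h.symm₁ d
      rw [show s₁ - d = d - 1 by omega, t0, t1] at this
      exact hκ.ne this
    have t2 : p₁ 1 = 0 := by rw [← h.symm₁, show s₁ - 1 = d - 1 by omega, t1]
    have b2 : p₂ 2 = 0 := by
      rw [h.shift (c := 1) (by omega) (by omega) (by omega), t2]
    have b1 : p₂ 1 = κ := h.eq₂ (by omega) (by omega) (Or.inl t2)
    have := two₂ b0 b1 b2
    have hd : (d : ℤ) = 2 := by omega
    exact ⟨by omega, Or.inr (Or.inr ⟨by omega, by omega, t2⟩), fun _ => by omega,
      fun _ => ⟨b0, b1⟩⟩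

end IsModuliPair

end Classification

end

end TLPairs

namespace TLPairs

noncomputable section

section Pairs

variable {d J J₁ J₂ : ℕ} {m m₁ m₂ : ℤ} {q Q : ℝ}

/-- The sum of the indices in the support of the `i`-th vector of a pair. -/
def indexSum (d : ℕ) (m₁ m₂ : ℤ) : Fin 2 → ℤ := ![d - m₁, d - m₂]

lemma isOrtho_iff {n : ℕ} {v : Fin 2 → Fin n × Fin n → ℂ} (h0 : star (v 0) ⬝ᵥ v 0 = 1)
    (h1 : star (v 1) ⬝ᵥ v 1 = 1) : IsOrtho v ↔ star (v 0) ⬝ᵥ v 1 = 0 := by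
  constructor
  · intro h
    simpa using h 0 1
  · intro h
    have h' : star (v 1) ⬝ᵥ v 0 = 0 := by
      have := congrArg star h
      rwa [Matrix.star_dotProduct, star_star, star_zero] at this
    intro i k
    fin_cases i <;> fin_cases k <;> simp [h0, h1, h, h']

lemma isTLPairWith_iff (hQ : 0 < Q) : IsTLPairWith d q Q J₁ m₁ J₂ m₂ ↔
    ∃ v : Fin 2 → Fin (d + 1) × Fin (d + 1) → ℂ,
      IsKet d q J₁ m₁ (v 0) ∧ IsKet d q J₂ m₂ (v 1) ∧ star (v 0) ⬝ᵥ v 1 = 0 ∧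
      ((Q : ℂ) ^ 2) • ((overlap v)ᴴ * overlap v) = 1 := by
  constructor
  · rintro ⟨v₁, v₂, P, h1, h2, h12, hP, hT⟩
    have ho : IsOrtho ![v₁, v₂] := (isOrtho_iff h1.2.2.1 h2.2.2.1).2 h12
    rw [(isProjOnSpan_iff ho P).1 hP] at hT
    exact ⟨![v₁, v₂], h1, h2, h12, (isTLSolution_iff ho hQ).1 hT⟩
  · rintro ⟨v, h1, h2, h12, h⟩
    have ho : IsOrtho v := (isOrtho_iff h1.2.2.1 h2.2.2.1).2 h12
    exact ⟨v 0, v 1, spanProj v, h1, h2, h12, (isProjOnSpan_iff ho _).2 rfl,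
      (isTLSolution_iff ho hQ).2 h⟩

lemma IsTLPairWith.symm (h : IsTLPairWith d q Q J₁ m₁ J₂ m₂) :
    IsTLPairWith d q Q J₂ m₂ J₁ m₁ := by
  obtain ⟨v₁, v₂, P, h1, h2, h12, ⟨hP, hPP, hr⟩, hT⟩ := h
  refine ⟨v₂, v₁, P, h2, h1, ?_, ⟨hP, hPP, ?_⟩, hT⟩
  · have := congrArg star h12
    rwa [Matrix.star_dotProduct, star_star, star_zero] at this
  · rw [hr, Set.pair_comm]

lemma isTLPairWith_comm :
    IsTLPairWith d q Q J₁ m₁ J₂ m₂ ↔ IsTLPairWith d q Q J₂ m₂ J₁ m₁ :=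
  ⟨IsTLPairWith.symm, IsTLPairWith.symm⟩

lemma suppOn_indexSum (hq : 0 < q) {v : Fin 2 → Fin (d + 1) × Fin (d + 1) → ℂ}
    (h1 : IsKet d q J₁ m₁ (v 0)) (h2 : IsKet d q J₂ m₂ (v 1)) (i : Fin 2) :
    SuppOn (v i) (indexSum d m₁ m₂ i) := by
  fin_cases i
  · exact ((isKet_iff hq).1 h1).2.2.2.1
  · exact ((isKet_iff hq).1 h2).2.2.2.1

lemma IsTLPairWith.weight_ne (hq : 0 < q) (hQ : 0 < Q)
    (h : IsTLPairWith d q Q J₁ m₁ J₂ m₂) : m₁ ≠ m₂ := by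
  obtain ⟨v, h1, h2, -, h⟩ := (isTLPairWith_iff hQ).1 h
  have := TLPairs.weight_ne (suppOn_indexSum hq h1 h2) (Nat.succ_pos d) hQ h
  simp only [indexSum, Matrix.cons_val_zero, Matrix.cons_val_one] at this
  omega

/-- The relations between the moduli of the coefficients. -/
lemma ket_prob_relation (hq : 0 < q) {v : Fin 2 → Fin (d + 1) × Fin (d + 1) → ℂ}
    (h1 : IsKet d q J₁ m₁ (v 0)) (h2 : IsKet d q J₂ m₂ (v 1))
    (h : ((Q : ℂ) ^ 2) • ((overlap v)ᴴ * overlap v) = 1) {c : ℤ} (hc : 0 ≤ c) (hc' : c ≤ d) :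
    prob (v 0) (d - m₁) c * prob (v 0) (d - m₁) (d - m₁ - c) +
      prob (v 1) (d - m₂) c * prob (v 0) (d - m₁) (d - m₂ - c) = Q⁻¹ ^ 2 ∧
    prob (v 0) (d - m₁) c * prob (v 1) (d - m₂) (d - m₁ - c) +
      prob (v 1) (d - m₂) c * prob (v 1) (d - m₂) (d - m₂ - c) = Q⁻¹ ^ 2 :=
  ⟨prob_relation (suppOn_indexSum hq h1 h2) h 0 hc (by push_cast; omega),
    prob_relation (suppOn_indexSum hq h1 h2) h 1 hc (by push_cast; omega)⟩

lemma IsKet.isChain {v : Fin (d + 1) × Fin (d + 1) → ℂ} (h : IsKet d 1 J m v) :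
    IsChain d J m (coeff v (d - m)) where
  supp c hc := by
    by_contra h0
    exact hc (coeff_eq_zero v (by push_cast; omega))
  step c h1 h2 h3 h4 := by
    have e := zext_ext.1 ((isKet_iff one_pos).1 h).2.2.2.2 (d - m - c) c h3
      (by push_cast; omega) h1 (by push_cast; omega)
    rw [zext_lower_raise _ h3 h4 h1 h2, zext_smul] at e
    have hl : ∀ a, ladder d 1 a = root d a := fun a => by simp [ladder, root, qNum]
    simp only [Real.one_rpow, Complex.ofReal_one, mul_one, one_mul, hl, lowerRaise, qNum,
      if_true] at e
    rw [coeff, coeff, coeff, show (d : ℤ) - m - (c + 1) = d - m - c - 1 by ring,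
      show (d : ℤ) - m - (c - 1) = d - m - c + 1 by ring]
    have r1 := root_sq d h3 (by omega)
    have r2 := root_sq d h1 (by omega)
    have r1' : (root d (d - m - c) : ℂ) ^ 2 = ((d - m - c : ℤ) : ℂ) * (d + 1 - (d - m - c : ℤ)) := by
      exact_mod_cast r1
    have r2' : (root d c : ℂ) ^ 2 = (c : ℂ) * (d + 1 - c) := by exact_mod_cast r2
    push_cast at e r1' ⊢
    linear_combination e - r1' * zext v (d - m - c) c - r2' * zext v (d - m - c) c

lemma IsKet.sum_prob_two (hq : 0 < q) {v : Fin (2 + 1) × Fin (2 + 1) → ℂ}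
    (h : IsKet 2 q J m v) :
    prob v (2 - m) 0 + prob v (2 - m) 1 + prob v (2 - m) 2 = 1 := by
  have := sum_prob ((isKet_iff hq).1 h).2.2.2.1 h.2.2.1
  rw [Fin.sum_univ_three] at this
  simpa using this

lemma IsKet.eq_one_of_middle {v : Fin (2 + 1) × Fin (2 + 1) → ℂ} (h : IsKet 2 1 J 0 v)
    (h0 : prob v (2 - 0) 1 = 0) : J = 1 := by
  have hc := h.isChain
  have g1 : coeff v ((2 : ℕ) - 0) 1 = 0 := Complex.normSq_eq_zero.1 h0
  have g2 : coeff v ((2 : ℕ) - 0) 2 ≠ 0 := by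
    intro h2
    have h3 := hc.eq_zero le_rfl h2
    have h4 : ∀ c, prob v (2 - 0) c = 0 := fun c => by
      have := congrFun h3 c
      rw [prob]
      exact Complex.normSq_eq_zero.2 this
    have h5 := h.sum_prob_two one_pos
    rw [h4, h4, h4] at h5
    norm_num at h5
  have e := hc.step 2 (by norm_num) (by norm_num) (by norm_num) (by norm_num)
  have r3 : root 2 (2 + 1) = 0 := root_top 2
  have g1' : coeff v ((2 : ℕ) - 0) (2 - 1) = 0 := g1
  rw [r3, g1', mul_zero, mul_zero, Complex.ofReal_zero, zero_mul, zero_add] at e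
  have e2 := (mul_eq_zero.1 e.symm).resolve_right g2
  have e3 : (J : ℝ) * (J + 1) = 2 := by
    rw [Complex.ofReal_eq_zero] at e2
    push_cast at e2
    linarith
  have e4 : J * (J + 1) = 2 := by exact_mod_cast e3
  have : J ≤ 2 := h.1
  interval_cases J <;> omega

lemma classification_one (hQ : 0 < Q) (h : IsTLPairWith d 1 Q J₁ m₁ J₂ m₂) (hlt : m₁ < m₂) :
    d = 2 ∧ ((m₁ = -1 ∧ m₂ = 1) ∨ (m₁ = -1 ∧ m₂ = 0 ∧ J₂ = 1) ∨
      (m₁ = 0 ∧ m₂ = 1 ∧ J₁ = 1)) ∧ Q = 2 := by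
  obtain ⟨v, h1, h2, -, h⟩ := (isTLPairWith_iff hQ).1 h
  have c1 := h1.isChain
  have c2 := h2.isChain
  have hpair : IsModuliPair d (d - m₁) (d - m₂) Q⁻¹ (prob (v 0) (d - m₁))
      (prob (v 1) (d - m₂)) :=
    { pos := inv_pos.2 hQ
      lt := by omega
      nonneg₁ := prob_nonneg _ _
      nonneg₂ := prob_nonneg _ _
      supp₁ := fun c hc => c1.supp c fun h0 => hc (by rw [prob, h0, map_zero])
      supp₂ := fun c hc => c2.supp c fun h0 => hc (by rw [prob, h0, map_zero])
      symm₁ := c1.normSq_swap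
      symm₂ := c2.normSq_swap
      rel₁ := fun c hc hc' => (ket_prob_relation one_pos h1 h2 h hc hc').1
      rel₂ := fun c hc hc' => (ket_prob_relation one_pos h1 h2 h hc hc').2 }
  have hκ : Q⁻¹ ≠ 0 := (inv_pos.2 hQ).ne'
  have ne0 : ∀ {w : Fin (d + 1) × Fin (d + 1) → ℂ} {s c}, prob w s c = Q⁻¹ → coeff w s c ≠ 0 := by
    intro w s c hp h0
    rw [prob, h0, map_zero] at hp
    exact hκ hp.symm
  have f0 : coeff (v 1) (d - m₂) (d - (d : ℤ)) = coeff (v 1) (d - m₂) 0 := by rw [sub_self]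
  have f1 : coeff (v 1) (d - m₂) (d - (d - 1 : ℤ)) = coeff (v 1) (d - m₂) 1 := by
    rw [sub_sub_cancel]
  have f2 : coeff (v 1) (d - m₂) (d - (d - 2 : ℤ)) = coeff (v 1) (d - m₂) 2 := by
    rw [sub_sub_cancel]
  obtain ⟨rfl, hcase, hv1, hv2⟩ := hpair.classification
    (fun a b c => by
      have := c1.top_two (ne0 a) (b.trans a.symm) (Complex.normSq_eq_zero.1 c)
      omega)
    (fun a b c => by
      have := c1.top_three (ne0 a) (b.trans a.symm) (c.trans a.symm)
      omega)
    (fun a b c => by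
      have := c2.flip.top_two (by simp only [f0]; exact ne0 a)
        (by simp only [f0, f1]; exact b.trans a.symm)
        (by simp only [f2]; exact Complex.normSq_eq_zero.1 c)
      omega)
    (fun a b c => by
      have := c2.flip.top_three (by simp only [f0]; exact ne0 a)
        (by simp only [f0, f1]; exact b.trans a.symm)
        (by simp only [f0, f2]; exact c.trans a.symm)
      omega)
  refine ⟨rfl, ?_, ?_⟩
  · rcases hcase with ⟨a, b⟩ | ⟨a, b, c⟩ | ⟨a, b, c⟩
    · left; omega
    · obtain rfl : m₂ = 0 := by omega
      exact Or.inr (Or.inl ⟨by omega, rfl, h2.eq_one_of_middle c⟩)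
    · obtain rfl : m₁ = 0 := by omega
      exact Or.inr (Or.inr ⟨rfl, by omega, h1.eq_one_of_middle c⟩)
  · have key : 2 * Q⁻¹ = 1 := by
      rcases (by omega : m₁ = -1 ∨ m₂ = 1) with rfl | rfl
      · have hs := h1.sum_prob_two one_pos
        obtain ⟨e1, e2⟩ := hv1 (by norm_num)
        have e0 : prob (v 0) (2 - -1) 0 = 0 := prob_eq_zero _ (by norm_num)
        norm_num at e0 e1 e2 hs
        linarith
      · have hs := h2.sum_prob_two one_pos
        obtain ⟨e1, e2⟩ := hv2 (by norm_num)
        have e0 : prob (v 1) (2 - 1) 2 = 0 := prob_eq_zero _ (by norm_num)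
        norm_num at e0 e1 e2 hs
        linarith
    field_simp at key
    linarith

end Pairs

end

end TLPairs

namespace TLPairs

noncomputable section

/-! ### Spin one -/

section SpinOne

variable {J J₁ J₂ : ℕ} {m : ℤ} {q Q : ℝ}

lemma qNum_one (hq : 0 < q) : qNum q 1 = 1 := by
  by_cases h : q = 1
  · simp [qNum, h]
  · have hqq : q - q⁻¹ ≠ 0 := by
      intro h0
      field_simp at h0
      apply h
      nlinarith
    rw [qNum, if_neg h, Real.rpow_one, Real.rpow_neg_one, div_self hqq]

lemma qNum_add_one (hq : 0 < q) (t : ℝ) :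
    qNum q (t + 1) = q * qNum q t + q ^ (-t) := by
  by_cases h : q = 1
  · simp [qNum, h]
  · have hqq : q - q⁻¹ ≠ 0 := by
      intro h0
      field_simp at h0
      apply h
      nlinarith
    rw [qNum, qNum, if_neg h, if_neg h, neg_add, Real.rpow_add hq, Real.rpow_add hq,
      Real.rpow_one, Real.rpow_neg_one]
    rw [eq_comm, ← eq_sub_iff_add_eq', ← mul_div_assoc, ← sub_div, eq_div_iff hqq]
    ring

lemma qNum_two (hq : 0 < q) : qNum q 2 = q + q⁻¹ := by
  have := qNum_add_one hq 1
  rw [qNum_one hq, Real.rpow_neg_one] at this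
  norm_num at this
  exact this

lemma qNum_three (hq : 0 < q) : qNum q 3 = q ^ 2 + 1 + (q ^ 2)⁻¹ := by
  have := qNum_add_one hq 2
  rw [qNum_two hq, Real.rpow_neg hq.le] at this
  norm_num at this
  rw [this]
  field_simp

lemma ladder_two_one (hq : 0 < q) : ladder 2 q 1 = Real.sqrt (q + q⁻¹) := by
  have : ((2 : ℕ) : ℝ) + 1 - (1 : ℤ) = 2 := by norm_num
  rw [ladder, this, Int.cast_one, qNum_one hq, qNum_two hq, one_mul]

lemma ladder_two_two (hq : 0 < q) : ladder 2 q 2 = Real.sqrt (q + q⁻¹) := by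
  have : ((2 : ℕ) : ℝ) + 1 - (2 : ℤ) = 1 := by norm_num
  rw [ladder, this, Int.cast_ofNat, qNum_one hq, qNum_two hq, mul_one]

lemma ladder_two_three (q : ℝ) : ladder 2 q 3 = 0 := by
  have : ((2 : ℕ) : ℝ) + 1 - (3 : ℤ) = 0 := by norm_num
  rw [ladder, this, qNum_zero, mul_zero, Real.sqrt_zero]

lemma rpow_wt_two (q : ℝ) : q ^ wt 2 0 = q ∧ q ^ wt 2 1 = 1 ∧ q ^ wt 2 2 = q⁻¹ := by
  refine ⟨?_, ?_, ?_⟩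
  · simp [wt]
  · simp [wt]
  · rw [← Real.rpow_neg_one]
    norm_num [wt]

lemma rpow_neg_wt_two (q : ℝ) :
    q ^ (-wt 2 0) = q⁻¹ ∧ q ^ (-wt 2 1) = 1 ∧ q ^ (-wt 2 2) = q := by
  refine ⟨?_, ?_, ?_⟩
  · rw [← Real.rpow_neg_one]
    norm_num [wt]
  · simp [wt]
  · norm_num [wt]

/-- The operator `Δ(X⁻) Δ(X⁺)` for spin one. -/
lemma lower_raise_two (hq : 0 < q) (v w : Fin (2 + 1) × Fin (2 + 1) → ℂ)
    (hw : deltaX 2 q (lower 2 q) *ᵥ (deltaX 2 q (raise 2 q) *ᵥ v) = w) :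
    w (0, 0) = 0 ∧
    w (0, 1) = ((q : ℂ) + (q : ℂ)⁻¹) * ((q : ℂ)⁻¹ ^ 2 * v (0, 1) + v (1, 0)) ∧
    w (1, 0) = ((q : ℂ) + (q : ℂ)⁻¹) * (v (0, 1) + q ^ 2 * v (1, 0)) ∧
    w (0, 2) = ((q : ℂ) + (q : ℂ)⁻¹) * ((q : ℂ)⁻¹ ^ 2 * v (0, 2) + (q : ℂ)⁻¹ * v (1, 1)) ∧
    w (1, 1) = ((q : ℂ) + (q : ℂ)⁻¹) * ((q : ℂ)⁻¹ * v (0, 2) + 2 * v (1, 1) + q * v (2, 0)) ∧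
    w (2, 0) = ((q : ℂ) + (q : ℂ)⁻¹) * (q * v (1, 1) + q ^ 2 * v (2, 0)) ∧
    w (1, 2) = ((q : ℂ) + (q : ℂ)⁻¹) * (((q : ℂ)⁻¹ ^ 2 + 1) * v (1, 2) + v (2, 1)) ∧
    w (2, 1) = ((q : ℂ) + (q : ℂ)⁻¹) * (v (1, 2) + (1 + q ^ 2) * v (2, 1)) ∧
    w (2, 2) = ((q : ℂ) + (q : ℂ)⁻¹) * (((q : ℂ)⁻¹ ^ 2 + q ^ 2) * v (2, 2)) := by
  have hs : ((Real.sqrt (q + q⁻¹) : ℝ) : ℂ) ^ 2 = (q : ℂ) + (q : ℂ)⁻¹ := by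
    have := Real.sq_sqrt (by positivity : 0 ≤ q + q⁻¹)
    exact_mod_cast this
  have hq' : (q : ℂ) ≠ 0 := by exact_mod_cast hq.ne'
  have z : ∀ (u : Fin (2 + 1) × Fin (2 + 1) → ℂ), zext u 0 0 = u (0, 0) ∧
      zext u 0 1 = u (0, 1) ∧ zext u 1 0 = u (1, 0) ∧ zext u 0 2 = u (0, 2) ∧
      zext u 1 1 = u (1, 1) ∧ zext u 2 0 = u (2, 0) ∧ zext u 1 2 = u (1, 2) ∧
      zext u 2 1 = u (2, 1) ∧ zext u 2 2 = u (2, 2) := fun u =>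
    ⟨rfl, rfl, rfl, rfl, rfl, rfl, rfl, rfl, rfl⟩
  obtain ⟨w00, w01, w10, w02, w11, w20, w12, w21, w22⟩ := z w
  obtain ⟨v00, v01, v10, v02, v11, v20, v12, v21, v22⟩ := z v
  have hone : (1 : ℤ) + 1 = 2 := rfl
  have htwo : (2 : ℤ) + 1 = 3 := rfl
  have hsub : (2 : ℤ) - 1 = 1 := rfl
  rw [← w00, ← w01, ← w10, ← w02, ← w11, ← w20, ← w12, ← w21, ← w22, ← hw]
  refine ⟨?_, ?_, ?_, ?_, ?_, ?_, ?_, ?_, ?_⟩ <;>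
    rw [zext_lower_raise v (by norm_num) (by norm_num) (by norm_num) (by norm_num)] <;>
    simp only [zero_add, sub_self, hone, htwo, hsub, ladder_zero, ladder_two_one hq,
      ladder_two_two hq, ladder_two_three, rpow_wt_two, rpow_neg_wt_two, v00, v01, v10, v02,
      v11, v20, v12, v21, v22, Complex.ofReal_zero, zero_mul, mul_zero, add_zero,
      Complex.ofReal_one, Complex.ofReal_inv, mul_one, one_mul] <;>
    rw [← hs] <;> generalize ((Real.sqrt (q + q⁻¹) : ℝ) : ℂ) = l <;> field_simp <;> try ring

lemma lowerRaise_two (hq : 0 < q) :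
    lowerRaise q 1 (-1) = q + q⁻¹ ∧
    lowerRaise q 2 (-1) = (q + q⁻¹) * (q ^ 2 + 1 + q⁻¹ ^ 2) ∧
    lowerRaise q 1 1 = 0 ∧
    lowerRaise q 2 1 = (q + q⁻¹) * (q ^ 2 + q⁻¹ ^ 2) ∧
    lowerRaise q 1 0 = q + q⁻¹ := by
  have h2 : (1 : ℝ) + 1 = 2 := by norm_num
  have h3 : (2 : ℝ) + 1 = 3 := by norm_num
  refine ⟨?_, ?_, ?_, ?_, ?_⟩ <;> unfold lowerRaise <;> push_cast <;>
    simp only [h2, h3, zero_add, neg_add_cancel, qNum_zero, qNum_one hq, qNum_two hq,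
      qNum_three hq] <;> ring

lemma J_cases {v : Fin (2 + 1) × Fin (2 + 1) → ℂ} (h : IsKet 2 q J m v) (hm : |m| = 1) :
    J = 1 ∨ J = 2 := by
  have h1 := h.1
  have h2 := h.2.1
  rw [hm] at h2
  omega

lemma add_inv_ne_zero (hq : 0 < q) : (q : ℂ) + (q : ℂ)⁻¹ ≠ 0 := by
  have : q + q⁻¹ ≠ 0 := by positivity
  exact_mod_cast this

lemma ket_neg_one_one {v : Fin (2 + 1) × Fin (2 + 1) → ℂ} (hq : 0 < q)
    (h : IsKet 2 q 1 (-1) v) : v (2, 1) = -((q : ℂ)⁻¹ ^ 2) * v (1, 2) := by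
  obtain ⟨-, -, -, -, -, -, e, -, -⟩ := lower_raise_two hq v _ ((isKet_iff hq).1 h).2.2.2.2
  rw [(lowerRaise_two hq).1, Pi.smul_apply, smul_eq_mul] at e
  push_cast at e
  linear_combination -(mul_left_cancel₀ (add_inv_ne_zero hq) e)

lemma ket_neg_one_two {v : Fin (2 + 1) × Fin (2 + 1) → ℂ} (hq : 0 < q)
    (h : IsKet 2 q 2 (-1) v) : v (2, 1) = (q : ℂ) ^ 2 * v (1, 2) := by
  obtain ⟨-, -, -, -, -, -, e, -, -⟩ := lower_raise_two hq v _ ((isKet_iff hq).1 h).2.2.2.2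
  rw [(lowerRaise_two hq).2.1, Pi.smul_apply, smul_eq_mul] at e
  push_cast at e
  rw [mul_assoc] at e
  linear_combination -(mul_left_cancel₀ (add_inv_ne_zero hq) e)

lemma ket_one_one {v : Fin (2 + 1) × Fin (2 + 1) → ℂ} (hq : 0 < q)
    (h : IsKet 2 q 1 1 v) : v (1, 0) = -((q : ℂ)⁻¹ ^ 2) * v (0, 1) := by
  obtain ⟨-, e, -⟩ := lower_raise_two hq v _ ((isKet_iff hq).1 h).2.2.2.2
  rw [(lowerRaise_two hq).2.2.1, Complex.ofReal_zero, zero_smul, Pi.zero_apply,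
    ← mul_zero ((q : ℂ) + (q : ℂ)⁻¹)] at e
  linear_combination -(mul_left_cancel₀ (add_inv_ne_zero hq) e)

lemma ket_one_two {v : Fin (2 + 1) × Fin (2 + 1) → ℂ} (hq : 0 < q)
    (h : IsKet 2 q 2 1 v) : v (1, 0) = (q : ℂ) ^ 2 * v (0, 1) := by
  obtain ⟨-, e, -⟩ := lower_raise_two hq v _ ((isKet_iff hq).1 h).2.2.2.2
  rw [(lowerRaise_two hq).2.2.2.1, Pi.smul_apply, smul_eq_mul] at e
  push_cast at e
  rw [mul_assoc] at e
  linear_combination -(mul_left_cancel₀ (add_inv_ne_zero hq) e)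

lemma prob_neg_one (v : Fin (2 + 1) × Fin (2 + 1) → ℂ) :
    prob v (2 - -1) 0 = 0 ∧ prob v (2 - -1) 1 = Complex.normSq (v (2, 1)) ∧
      prob v (2 - -1) 2 = Complex.normSq (v (1, 2)) :=
  ⟨prob_eq_zero v (by norm_num), rfl, rfl⟩

lemma prob_one (v : Fin (2 + 1) × Fin (2 + 1) → ℂ) :
    prob v (2 - 1) 0 = Complex.normSq (v (1, 0)) ∧
      prob v (2 - 1) 1 = Complex.normSq (v (0, 1)) ∧ prob v (2 - 1) 2 = 0 :=
  ⟨rfl, rfl, prob_eq_zero v (by norm_num)⟩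

/-- The moduli of the coefficients of `|J,-1⟩_q`. -/
lemma ket_neg_one_prob {v : Fin (2 + 1) × Fin (2 + 1) → ℂ} (hq : 0 < q)
    (h : IsKet 2 q J (-1) v) :
    prob v (2 - -1) 1 + prob v (2 - -1) 2 = 1 ∧
      (J = 1 → q ^ 4 * prob v (2 - -1) 1 = prob v (2 - -1) 2) ∧
      (J = 2 → prob v (2 - -1) 1 = q ^ 4 * prob v (2 - -1) 2) := by
  obtain ⟨p0, p1, p2⟩ := prob_neg_one v
  have hs := h.sum_prob_two hq
  rw [p0, zero_add] at hs
  have hq0 := hq.ne'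
  refine ⟨hs, ?_, ?_⟩
  · rintro rfl
    rw [p1, p2, ket_neg_one_one hq h, map_mul, Complex.normSq_neg, map_pow, map_inv₀,
      Complex.normSq_ofReal]
    field_simp
  · rintro rfl
    rw [p1, p2, ket_neg_one_two hq h, map_mul, map_pow, Complex.normSq_ofReal]
    ring

/-- The moduli of the coefficients of `|J,1⟩_q`. -/
lemma ket_one_prob {v : Fin (2 + 1) × Fin (2 + 1) → ℂ} (hq : 0 < q)
    (h : IsKet 2 q J 1 v) :
    prob v (2 - 1) 0 + prob v (2 - 1) 1 = 1 ∧
      (J = 1 → q ^ 4 * prob v (2 - 1) 0 = prob v (2 - 1) 1) ∧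
      (J = 2 → prob v (2 - 1) 0 = q ^ 4 * prob v (2 - 1) 1) := by
  obtain ⟨p0, p1, p2⟩ := prob_one v
  have hs := h.sum_prob_two hq
  rw [p2, add_zero] at hs
  have hq0 := hq.ne'
  refine ⟨hs, ?_, ?_⟩
  · rintro rfl
    rw [p0, p1, ket_one_one hq h, map_mul, Complex.normSq_neg, map_pow, map_inv₀,
      Complex.normSq_ofReal]
    field_simp
  · rintro rfl
    rw [p0, p1, ket_one_two hq h, map_mul, map_pow, Complex.normSq_ofReal]
    ring

lemma ket_zero_prob {v : Fin (2 + 1) × Fin (2 + 1) → ℂ} (hq : 0 < q) (hq1 : q ≠ 1)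
    (h : IsKet 2 q 1 0 v) : prob v (2 - 0) 1 ≠ 0 := by
  intro h0
  have h11 : v (1, 1) = 0 := Complex.normSq_eq_zero.1 h0
  have hs := h.sum_prob_two hq
  obtain ⟨-, -, -, e, -, e', -⟩ := lower_raise_two hq v _ ((isKet_iff hq).1 h).2.2.2.2
  rw [(lowerRaise_two hq).2.2.2.2, Pi.smul_apply, smul_eq_mul, h11] at e e'
  push_cast at e e'
  have f := mul_left_cancel₀ (add_inv_ne_zero hq) e
  have f' := mul_left_cancel₀ (add_inv_ne_zero hq) e'
  have hq2 : ((q : ℂ) ^ 2 - 1) ≠ 0 := by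
    intro h1
    have h2 : q ^ 2 - 1 = 0 := by exact_mod_cast h1
    apply hq1
    nlinarith
  have hqc : (q : ℂ) ≠ 0 := by exact_mod_cast hq.ne'
  have v20 : v (2, 0) = 0 := by
    have : ((q : ℂ) ^ 2 - 1) * v (2, 0) = 0 := by linear_combination -f'
    exact (mul_eq_zero.1 this).resolve_left hq2
  have v02 : v (0, 2) = 0 := by
    have : ((q : ℂ) ^ 2 - 1) * v (0, 2) = 0 := by
      field_simp at f
      linear_combination f
    exact (mul_eq_zero.1 this).resolve_left hq2
  have p0 : prob v (2 - 0) 0 = Complex.normSq (v (2, 0)) := rfl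
  have p2 : prob v (2 - 0) 2 = Complex.normSq (v (0, 2)) := rfl
  rw [h0, p0, p2, v20, v02, map_zero] at hs
  norm_num at hs

lemma opposite_weights (hq : 0 < q) (hQ : 0 < Q) (h : IsTLPairWith 2 q Q J₁ (-1) J₂ 1) :
    Q = q ^ 2 + (q ^ 2)⁻¹ ∧ (J₁ = J₂ → q = 1) := by
  obtain ⟨v, h1, h2, -, h⟩ := (isTLPairWith_iff hQ).1 h
  have r0 := (ket_prob_relation hq h1 h2 h (c := 0) le_rfl (by norm_num)).1
  have r1 := (ket_prob_relation hq h1 h2 h (c := 1) (by norm_num) (by norm_num)).1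
  have j1 := J_cases h1 (by norm_num)
  have j2 := J_cases h2 (by norm_num)
  obtain ⟨s1, k11, k12⟩ := ket_neg_one_prob hq h1
  obtain ⟨s2, k21, k22⟩ := ket_one_prob hq h2
  have z1 := (prob_neg_one (v 0)).1
  have i1 : ((2 : ℕ) : ℤ) - 1 - 0 = 1 := rfl
  have i2 : ((2 : ℕ) : ℤ) - -1 - 1 = 2 := rfl
  have i3 : ((2 : ℕ) : ℤ) - 1 - 1 = 0 := rfl
  rw [i1] at r0
  rw [i2, i3] at r1
  simp only [Nat.cast_ofNat] at r0 r1
  rw [z1, zero_mul, zero_add] at r0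
  rw [z1, mul_zero, add_zero] at r1
  set x := prob (v 0) (2 - -1) 2
  set y := prob (v 0) (2 - -1) 1
  set w := prob (v 1) (2 - 1) 0
  set z := prob (v 1) (2 - 1) 1
  have hx : 0 ≤ x := prob_nonneg _ _ _
  have hκ : 0 < Q⁻¹ := inv_pos.2 hQ
  have hy : y ≠ 0 := by
    intro h0
    rw [h0, zero_mul] at r1
    exact (pow_pos hκ 2).ne r1
  have hwx : w = x := by
    have : w * y = x * y := by linarith
    exact mul_right_cancel₀ hy this
  have hx0 : x ≠ 0 := by
    intro h0
    rw [h0, mul_zero] at r1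
    exact (pow_pos hκ 2).ne r1
  have hzy : z = y := by linarith
  rw [hwx, hzy] at k21 k22
  have hq4 : q ^ 4 = (q ^ 2) ^ 2 := by ring
  constructor
  · have hQe : Q * Q⁻¹ = 1 := mul_inv_cancel₀ hQ.ne'
    rcases j1 with rfl | rfl
    · have e := k11 rfl
      have hy0 : 0 ≤ y := prob_nonneg _ _ _
      have e2 : q ^ 2 * y = Q⁻¹ :=
        (pow_left_inj₀ (by positivity) hκ.le two_ne_zero).1 (by rw [← r1, ← e]; ring)
      rw [← e2] at hQe
      have : y * (1 + q ^ 4) = 1 := by linarith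
      have e3 : y * (Q * q ^ 2) = y * (1 + q ^ 4) := by linarith
      have e4 := mul_left_cancel₀ hy e3
      field_simp
      linarith
    · have e := k12 rfl
      have e2 : q ^ 2 * x = Q⁻¹ :=
        (pow_left_inj₀ (by positivity) hκ.le two_ne_zero).1 (by rw [← r1, e]; ring)
      rw [← e2] at hQe
      have : x * (1 + q ^ 4) = 1 := by linarith
      have e3 : x * (Q * q ^ 2) = x * (1 + q ^ 4) := by linarith
      have e4 := mul_left_cancel₀ hx0 e3
      field_simp
      linarith
  · rintro rfl
    have key : q ^ 4 * q ^ 4 = 1 := by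
      rcases j1 with rfl | rfl
      · have e := k11 rfl
        have e' := k21 rfl
        rw [← e', ← mul_assoc] at e
        exact mul_right_cancel₀ hx0 (by rw [e, one_mul])
      · have e := k12 rfl
        have e' := k22 rfl
        rw [e', ← mul_assoc] at e
        exact mul_right_cancel₀ hy (by rw [← e, one_mul])
    exact (pow_eq_one_iff_of_nonneg hq.le (n := 8) (by norm_num)).1 (by linarith [pow_add q 4 4])

lemma neg_one_zero (hq : 0 < q) (hQ : 0 < Q) (h : IsTLPairWith 2 q Q J₁ (-1) 1 0) : q = 1 := by
  by_contra hq1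
  obtain ⟨v, h1, h2, -, h⟩ := (isTLPairWith_iff hQ).1 h
  have r0 := (ket_prob_relation hq h1 h2 h (c := 0) le_rfl (by norm_num)).2
  have r2 := (ket_prob_relation hq h1 h2 h (c := 2) (by norm_num) (by norm_num)).2
  obtain ⟨s1, k11, k12⟩ := ket_neg_one_prob hq h1
  have z1 := (prob_neg_one (v 0)).1
  have hp := ket_zero_prob hq hq1 h2
  have i1 : ((2 : ℕ) : ℤ) - 0 - 0 = 2 := rfl
  have i2 : ((2 : ℕ) : ℤ) - -1 - 2 = 1 := rfl
  have i3 : ((2 : ℕ) : ℤ) - 0 - 2 = 0 := rfl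
  rw [i1] at r0
  rw [i2, i3] at r2
  simp only [Nat.cast_ofNat] at r0 r2
  rw [z1, zero_mul, zero_add] at r0
  have hx : prob (v 0) (2 - -1) 2 = 0 := by
    have : prob (v 0) (2 - -1) 2 * prob (v 1) (2 - 0) 1 = 0 := by
      linear_combination r2 - r0
    exact (mul_eq_zero.1 this).resolve_right hp
  rw [hx] at s1 k11 k12
  have hq4 : q ^ 4 ≠ 0 := by positivity
  rcases J_cases h1 (by norm_num) with hJ | hJ
  · have := (mul_eq_zero.1 (k11 hJ)).resolve_left hq4
    linarith
  · have := k12 hJ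
    linarith

lemma zero_one (hq : 0 < q) (hQ : 0 < Q) (h : IsTLPairWith 2 q Q 1 0 J₂ 1) : q = 1 := by
  by_contra hq1
  obtain ⟨v, h1, h2, -, h⟩ := (isTLPairWith_iff hQ).1 h
  have r0 := (ket_prob_relation hq h1 h2 h (c := 0) le_rfl (by norm_num)).1
  have r2 := (ket_prob_relation hq h1 h2 h (c := 2) (by norm_num) (by norm_num)).1
  obtain ⟨s1, k11, k12⟩ := ket_one_prob hq h2
  have z1 := (prob_one (v 1)).2.2
  have hp := ket_zero_prob hq hq1 h1
  have i1 : ((2 : ℕ) : ℤ) - 0 - 0 = 2 := rfl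
  have i2 : ((2 : ℕ) : ℤ) - 1 - 0 = 1 := rfl
  have i3 : ((2 : ℕ) : ℤ) - 0 - 2 = 0 := rfl
  rw [i1, i2] at r0
  rw [i3] at r2
  simp only [Nat.cast_ofNat] at r0 r2
  rw [z1, zero_mul, add_zero] at r2
  have hx : prob (v 1) (2 - 1) 0 = 0 := by
    have : prob (v 1) (2 - 1) 0 * prob (v 0) (2 - 0) 1 = 0 := by
      linear_combination r0 - r2
    exact (mul_eq_zero.1 this).resolve_right hp
  rw [hx] at s1 k11 k12
  have hq4 : q ^ 4 ≠ 0 := by positivity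
  rcases J_cases h2 (by norm_num) with hJ | hJ
  · have := k11 hJ
    linarith
  · have := (mul_eq_zero.1 (k12 hJ).symm).resolve_left hq4
    linarith

end SpinOne

end

end TLPairs

namespace TLPairs

noncomputable section

section Existence

variable {J₁ J₂ : ℕ} {q Q t : ℝ}

/-- The vector with coordinates `α` at `x` and `β` at `y`. -/
def pairVec (x y : Fin (2 + 1) × Fin (2 + 1)) (α β : ℝ) : Fin (2 + 1) × Fin (2 + 1) → ℂ :=
  fun z => if z = x then (α : ℂ) else if z = y then (β : ℂ) else 0

lemma pairVec_left (x y : Fin (2 + 1) × Fin (2 + 1)) (α β : ℝ) : pairVec x y α β x = α := by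
  simp [pairVec]

lemma pairVec_right {x y : Fin (2 + 1) × Fin (2 + 1)} (h : x ≠ y) (α β : ℝ) :
    pairVec x y α β y = β := by
  simp [pairVec, h.symm]

lemma pairVec_eq_zero {x y z : Fin (2 + 1) × Fin (2 + 1)} (hx : z ≠ x) (hy : z ≠ y) (α β : ℝ) :
    pairVec x y α β z = 0 := by
  simp [pairVec, hx, hy]

lemma star_pairVec_dotProduct {x y : Fin (2 + 1) × Fin (2 + 1)} (h : x ≠ y) (α β : ℝ)
    (w : Fin (2 + 1) × Fin (2 + 1) → ℂ) :
    star (pairVec x y α β) ⬝ᵥ w = α * w x + β * w y := by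
  rw [dotProduct, Fintype.sum_eq_add x y h]
  · simp [pairVec_left, pairVec_right h]
  · rintro z ⟨hx, hy⟩
    simp [pairVec_eq_zero hx hy]

lemma isKet_pairVec (hq : 0 < q) {J : ℕ} {m : ℤ} (hJ : J ≤ 2) (hm : |m| ≤ (J : ℤ))
    {x y : Fin (2 + 1) × Fin (2 + 1)} (hxy : x ≠ y) {α β : ℝ} (hn : α ^ 2 + β ^ 2 = 1)
    (hx : ((x.1 : ℕ) : ℤ) + (x.2 : ℕ) = 2 - m) (hy : ((y.1 : ℕ) : ℤ) + (y.2 : ℕ) = 2 - m)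
    (hE : deltaX 2 q (lower 2 q) *ᵥ (deltaX 2 q (raise 2 q) *ᵥ pairVec x y α β) =
      ((lowerRaise q J m : ℝ) : ℂ) • pairVec x y α β) :
    IsKet 2 q J m (pairVec x y α β) := by
  refine (isKet_iff hq).2 ⟨hJ, hm, ?_, ?_, hE⟩
  · rw [star_pairVec_dotProduct hxy, pairVec_left, pairVec_right hxy]
    have : ((α ^ 2 + β ^ 2 : ℝ) : ℂ) = 1 := by rw [hn, Complex.ofReal_one]
    push_cast at this
    linear_combination this
  · have hw : ∀ z : Fin (2 + 1) × Fin (2 + 1), ((z.1 : ℕ) : ℤ) + (z.2 : ℕ) = 2 - m →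
        weight 2 z.1 + weight 2 z.2 = m := by
      intro z hz
      have : ((z.1 : ℕ) : ℝ) + (z.2 : ℕ) = 2 - m := by exact_mod_cast hz
      simp only [weight]
      push_cast
      linarith
    rw [suppOn_iff]
    intro z hz
    by_cases h1 : z = x
    · exact h1 ▸ hw x hx
    · by_cases h2 : z = y
      · exact h2 ▸ hw y hy
      · exact absurd (pairVec_eq_zero h1 h2 α β) hz

/-- A criterion for an eigenvector of `Δ(X⁻) Δ(X⁺)` with two nonzero coordinates, spin one. -/
lemma lower_raise_of_eqs (hq : 0 < q) {v : Fin (2 + 1) × Fin (2 + 1) → ℂ} {l : ℂ}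
    (h00 : 0 = l * v (0, 0))
    (h01 : (q + (q : ℂ)⁻¹) * ((q : ℂ)⁻¹ ^ 2 * v (0, 1) + v (1, 0)) = l * v (0, 1))
    (h10 : (q + (q : ℂ)⁻¹) * (v (0, 1) + q ^ 2 * v (1, 0)) = l * v (1, 0))
    (h02 : (q + (q : ℂ)⁻¹) * ((q : ℂ)⁻¹ ^ 2 * v (0, 2) + (q : ℂ)⁻¹ * v (1, 1)) = l * v (0, 2))
    (h11 : (q + (q : ℂ)⁻¹) * ((q : ℂ)⁻¹ * v (0, 2) + 2 * v (1, 1) + q * v (2, 0)) =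
      l * v (1, 1))
    (h20 : (q + (q : ℂ)⁻¹) * (q * v (1, 1) + q ^ 2 * v (2, 0)) = l * v (2, 0))
    (h12 : (q + (q : ℂ)⁻¹) * (((q : ℂ)⁻¹ ^ 2 + 1) * v (1, 2) + v (2, 1)) = l * v (1, 2))
    (h21 : (q + (q : ℂ)⁻¹) * (v (1, 2) + (1 + q ^ 2) * v (2, 1)) = l * v (2, 1))
    (h22 : (q + (q : ℂ)⁻¹) * (((q : ℂ)⁻¹ ^ 2 + q ^ 2) * v (2, 2)) = l * v (2, 2)) :
    deltaX 2 q (lower 2 q) *ᵥ (deltaX 2 q (raise 2 q) *ᵥ v) = l • v := by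
  obtain ⟨e00, e01, e10, e02, e11, e20, e12, e21, e22⟩ := lower_raise_two hq v _ rfl
  ext ⟨a, b⟩
  rw [Pi.smul_apply, smul_eq_mul]
  fin_cases a <;> fin_cases b
  exacts [e00.trans h00, e01.trans h01, e02.trans h02, e10.trans h10, e11.trans h11,
    e12.trans h12, e20.trans h20, e21.trans h21, e22.trans h22]

lemma isKet_neg_one_of (hq : 0 < q) {J : ℕ} (hJ : J = 1 ∨ J = 2) {α β : ℝ}
    (hn : α ^ 2 + β ^ 2 = 1)
    (h12 : (q + q⁻¹) * ((q⁻¹ ^ 2 + 1) * α + β) = lowerRaise q J (-1) * α)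
    (h21 : (q + q⁻¹) * (α + (1 + q ^ 2) * β) = lowerRaise q J (-1) * β) :
    IsKet 2 q J (-1) (pairVec (1, 2) (2, 1) α β) := by
  have z : ∀ x : Fin (2 + 1) × Fin (2 + 1), x ≠ (1, 2) → x ≠ (2, 1) →
      pairVec (1, 2) (2, 1) α β x = 0 := fun x hx hy => pairVec_eq_zero hx hy α β
  refine isKet_pairVec hq (by omega) ?_ (by decide) hn rfl rfl (lower_raise_of_eqs hq ?_ ?_ ?_
    ?_ ?_ ?_ ?_ ?_ ?_)
  · rw [abs_neg, abs_one]; omega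
  all_goals try simp [z]
  · rw [pairVec_left, pairVec_right (by decide)]
    rw [inv_pow] at h12
    exact_mod_cast h12
  · rw [pairVec_left, pairVec_right (by decide)]
    exact_mod_cast h21

lemma isKet_one_of (hq : 0 < q) {J : ℕ} (hJ : J = 1 ∨ J = 2) {α β : ℝ}
    (hn : α ^ 2 + β ^ 2 = 1)
    (h01 : (q + q⁻¹) * (q⁻¹ ^ 2 * α + β) = lowerRaise q J 1 * α)
    (h10 : (q + q⁻¹) * (α + q ^ 2 * β) = lowerRaise q J 1 * β) :
    IsKet 2 q J 1 (pairVec (0, 1) (1, 0) α β) := by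
  have z : ∀ x : Fin (2 + 1) × Fin (2 + 1), x ≠ (0, 1) → x ≠ (1, 0) →
      pairVec (0, 1) (1, 0) α β x = 0 := fun x hx hy => pairVec_eq_zero hx hy α β
  refine isKet_pairVec hq (by omega) ?_ (by decide) hn rfl rfl (lower_raise_of_eqs hq ?_ ?_ ?_
    ?_ ?_ ?_ ?_ ?_ ?_)
  · rw [abs_one]; omega
  all_goals try simp [z]
  · rw [pairVec_left, pairVec_right (by decide)]
    rw [inv_pow] at h01
    exact_mod_cast h01
  · rw [pairVec_left, pairVec_right (by decide)]
    exact_mod_cast h10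

lemma isKet_neg_one (hq : 0 < q) (ht : t ^ 2 * (q ^ 2 + q⁻¹ ^ 2) = 1) :
    IsKet 2 q 1 (-1) (pairVec (1, 2) (2, 1) (t * q) (-(t * q⁻¹))) ∧
      IsKet 2 q 2 (-1) (pairVec (1, 2) (2, 1) (t * q⁻¹) (t * q)) := by
  constructor
  · refine isKet_neg_one_of hq (Or.inl rfl) (by linarith) ?_ ?_ <;>
      rw [(lowerRaise_two hq).1] <;> field_simp <;> ring
  · refine isKet_neg_one_of hq (Or.inr rfl) (by linarith) ?_ ?_ <;>
      rw [(lowerRaise_two hq).2.1] <;> field_simp <;> ring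

lemma isKet_one (hq : 0 < q) (ht : t ^ 2 * (q ^ 2 + q⁻¹ ^ 2) = 1) :
    IsKet 2 q 1 1 (pairVec (0, 1) (1, 0) (t * q) (-(t * q⁻¹))) ∧
      IsKet 2 q 2 1 (pairVec (0, 1) (1, 0) (t * q⁻¹) (t * q)) := by
  constructor
  · refine isKet_one_of hq (Or.inl rfl) (by linarith) ?_ ?_ <;>
      rw [(lowerRaise_two hq).2.2.1] <;> field_simp <;> ring
  · refine isKet_one_of hq (Or.inr rfl) (by linarith) ?_ ?_ <;>
      rw [(lowerRaise_two hq).2.2.2.1] <;> field_simp <;> ring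

lemma isKet_zero (ht : t ^ 2 * 2 = 1) :
    IsKet 2 1 1 0 (pairVec (0, 2) (2, 0) t (-t)) := by
  refine isKet_pairVec one_pos (by norm_num) (by norm_num) (by decide) (by linarith) rfl rfl ?_
  rw [(lowerRaise_two one_pos).2.2.2.2]
  apply lower_raise_of_eqs one_pos <;> simp [pairVec]

lemma gram_opposite {α β γ δ : ℝ} (h1 : Q ^ 2 * (α * β) ^ 2 = 1) (h2 : Q ^ 2 * (γ * δ) ^ 2 = 1)
    (h3 : Q ^ 2 * (β * δ) ^ 2 = 1) (h4 : Q ^ 2 * (α * γ) ^ 2 = 1) :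
    ((Q : ℂ) ^ 2) • ((overlap ![pairVec (1, 2) (2, 1) α β, pairVec (0, 1) (1, 0) γ δ])ᴴ *
      overlap ![pairVec (1, 2) (2, 1) α β, pairVec (0, 1) (1, 0) γ δ]) = 1 := by
  have h1' : (Q : ℂ) ^ 2 * (α * β) ^ 2 = 1 := by exact_mod_cast h1
  have h2' : (Q : ℂ) ^ 2 * (γ * δ) ^ 2 = 1 := by exact_mod_cast h2
  have h3' : (Q : ℂ) ^ 2 * (β * δ) ^ 2 = 1 := by exact_mod_cast h3
  have h4' : (Q : ℂ) ^ 2 * (α * γ) ^ 2 = 1 := by exact_mod_cast h4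
  ext ⟨i, a⟩ ⟨k, c⟩
  fin_cases i <;> fin_cases a <;> fin_cases k <;> fin_cases c <;>
    simp [Matrix.mul_apply, overlap, Fintype.sum_prod_type, Fin.sum_univ_three, pairVec] <;>
    first
    | linear_combination h1'
    | linear_combination h2'
    | linear_combination h3'
    | linear_combination h4'

lemma gram_neg_one_zero {α β γ δ : ℝ} (h1 : Q ^ 2 * (α * β) ^ 2 = 1)
    (h2 : Q ^ 2 * (γ * δ) ^ 2 = 1) (h3 : Q ^ 2 * (α * δ) ^ 2 = 1)
    (h4 : Q ^ 2 * (β * γ) ^ 2 = 1) :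
    ((Q : ℂ) ^ 2) • ((overlap ![pairVec (1, 2) (2, 1) α β, pairVec (0, 2) (2, 0) γ δ])ᴴ *
      overlap ![pairVec (1, 2) (2, 1) α β, pairVec (0, 2) (2, 0) γ δ]) = 1 := by
  have h1' : (Q : ℂ) ^ 2 * (α * β) ^ 2 = 1 := by exact_mod_cast h1
  have h2' : (Q : ℂ) ^ 2 * (γ * δ) ^ 2 = 1 := by exact_mod_cast h2
  have h3' : (Q : ℂ) ^ 2 * (α * δ) ^ 2 = 1 := by exact_mod_cast h3
  have h4' : (Q : ℂ) ^ 2 * (β * γ) ^ 2 = 1 := by exact_mod_cast h4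
  ext ⟨i, a⟩ ⟨k, c⟩
  fin_cases i <;> fin_cases a <;> fin_cases k <;> fin_cases c <;>
    simp [Matrix.mul_apply, overlap, Fintype.sum_prod_type, Fin.sum_univ_three, pairVec] <;>
    first
    | linear_combination h1'
    | linear_combination h2'
    | linear_combination h3'
    | linear_combination h4'

lemma gram_zero_one {α β γ δ : ℝ} (h1 : Q ^ 2 * (α * β) ^ 2 = 1)
    (h2 : Q ^ 2 * (γ * δ) ^ 2 = 1) (h3 : Q ^ 2 * (α * δ) ^ 2 = 1)
    (h4 : Q ^ 2 * (β * γ) ^ 2 = 1) :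
    ((Q : ℂ) ^ 2) • ((overlap ![pairVec (0, 2) (2, 0) α β, pairVec (0, 1) (1, 0) γ δ])ᴴ *
      overlap ![pairVec (0, 2) (2, 0) α β, pairVec (0, 1) (1, 0) γ δ]) = 1 := by
  have h1' : (Q : ℂ) ^ 2 * (α * β) ^ 2 = 1 := by exact_mod_cast h1
  have h2' : (Q : ℂ) ^ 2 * (γ * δ) ^ 2 = 1 := by exact_mod_cast h2
  have h3' : (Q : ℂ) ^ 2 * (α * δ) ^ 2 = 1 := by exact_mod_cast h3
  have h4' : (Q : ℂ) ^ 2 * (β * γ) ^ 2 = 1 := by exact_mod_cast h4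
  ext ⟨i, a⟩ ⟨k, c⟩
  fin_cases i <;> fin_cases a <;> fin_cases k <;> fin_cases c <;>
    simp [Matrix.mul_apply, overlap, Fintype.sum_prod_type, Fin.sum_univ_three, pairVec] <;>
    first
    | linear_combination h1'
    | linear_combination h2'
    | linear_combination h3'
    | linear_combination h4'

lemma exists_scale {N : ℝ} (hN : 0 < N) : ∃ t : ℝ, t ^ 2 * N = 1 :=
  ⟨(Real.sqrt N)⁻¹, by rw [inv_pow, Real.sq_sqrt hN.le, inv_mul_cancel₀ hN.ne']⟩

lemma isTLPairWith_opposite (hq : 0 < q) (h₁ : J₁ = 1 ∨ J₁ = 2) (h₂ : J₂ = 1 ∨ J₂ = 2)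
    (h : J₁ = J₂ → q = 1) : IsTLPairWith 2 q (q ^ 2 + (q ^ 2)⁻¹) J₁ (-1) J₂ 1 := by
  obtain ⟨t, ht⟩ := exists_scale (N := q ^ 2 + q⁻¹ ^ 2) (by positivity)
  obtain ⟨n1, n2⟩ := isKet_neg_one hq ht
  obtain ⟨p1, p2⟩ := isKet_one hq ht
  rw [isTLPairWith_iff (by positivity), ← inv_pow]
  have hqq : q * q⁻¹ = 1 := mul_inv_cancel₀ hq.ne'
  have key : (q ^ 2 + q⁻¹ ^ 2) ^ 2 * (t * q * (t * q⁻¹)) ^ 2 = 1 := by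
    calc _ = (t ^ 2 * (q ^ 2 + q⁻¹ ^ 2)) ^ 2 * (q * q⁻¹) ^ 2 := by ring
      _ = 1 := by rw [ht, hqq]; norm_num
  have ortho : ∀ α β γ δ : ℝ,
      star (pairVec (1, 2) (2, 1) α β) ⬝ᵥ pairVec (0, 1) (1, 0) γ δ = 0 := fun α β γ δ => by
    rw [star_pairVec_dotProduct (by decide)]
    simp [pairVec]
  rcases h₁ with rfl | rfl <;> rcases h₂ with rfl | rfl
  · obtain rfl := h rfl
    refine ⟨![_, _], n1, p1, ortho _ _ _ _, gram_opposite ?_ ?_ ?_ ?_⟩ <;>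
      refine Eq.trans ?_ key <;> ring
  · refine ⟨![_, _], n1, p2, ortho _ _ _ _, gram_opposite ?_ ?_ ?_ ?_⟩ <;>
      refine Eq.trans ?_ key <;> ring
  · refine ⟨![_, _], n2, p1, ortho _ _ _ _, gram_opposite ?_ ?_ ?_ ?_⟩ <;>
      refine Eq.trans ?_ key <;> ring
  · obtain rfl := h rfl
    refine ⟨![_, _], n2, p2, ortho _ _ _ _, gram_opposite ?_ ?_ ?_ ?_⟩ <;>
      refine Eq.trans ?_ key <;> ring

lemma isTLPairWith_neg_one_zero (h₁ : J₁ = 1 ∨ J₁ = 2) :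
    IsTLPairWith 2 1 2 J₁ (-1) 1 0 := by
  obtain ⟨t, ht⟩ := exists_scale (N := 2) (by norm_num)
  obtain ⟨n1, n2⟩ := isKet_neg_one one_pos (t := t) (by linear_combination ht)
  have z := isKet_zero ht
  rw [isTLPairWith_iff (by norm_num)]
  have key : 2 ^ 2 * (t * t) ^ 2 = 1 := by
    calc _ = (t ^ 2 * 2) ^ 2 := by ring
      _ = 1 := by rw [ht]; norm_num
  have ortho : ∀ α β γ δ : ℝ,
      star (pairVec (1, 2) (2, 1) α β) ⬝ᵥ pairVec (0, 2) (2, 0) γ δ = 0 := fun α β γ δ => by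
    rw [star_pairVec_dotProduct (by decide)]
    simp [pairVec]
  rcases h₁ with rfl | rfl
  · refine ⟨![_, _], n1, z, ortho _ _ _ _, gram_neg_one_zero ?_ ?_ ?_ ?_⟩ <;>
      refine Eq.trans ?_ key <;> ring
  · refine ⟨![_, _], n2, z, ortho _ _ _ _, gram_neg_one_zero ?_ ?_ ?_ ?_⟩ <;>
      refine Eq.trans ?_ key <;> ring

lemma isTLPairWith_zero_one (h₂ : J₂ = 1 ∨ J₂ = 2) :
    IsTLPairWith 2 1 2 1 0 J₂ 1 := by
  obtain ⟨t, ht⟩ := exists_scale (N := 2) (by norm_num)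
  obtain ⟨p1, p2⟩ := isKet_one one_pos (t := t) (by linear_combination ht)
  have z := isKet_zero ht
  rw [isTLPairWith_iff (by norm_num)]
  have key : 2 ^ 2 * (t * t) ^ 2 = 1 := by
    calc _ = (t ^ 2 * 2) ^ 2 := by ring
      _ = 1 := by rw [ht]; norm_num
  have ortho : ∀ α β γ δ : ℝ,
      star (pairVec (0, 2) (2, 0) α β) ⬝ᵥ pairVec (0, 1) (1, 0) γ δ = 0 := fun α β γ δ => by
    rw [star_pairVec_dotProduct (by decide)]
    simp [pairVec]
  rcases h₂ with rfl | rfl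
  · refine ⟨![_, _], z, p1, ortho _ _ _ _, gram_zero_one ?_ ?_ ?_ ?_⟩ <;>
      refine Eq.trans ?_ key <;> ring
  · refine ⟨![_, _], z, p2, ortho _ _ _ _, gram_zero_one ?_ ?_ ?_ ?_⟩ <;>
      refine Eq.trans ?_ key <;> ring

end Existence

end

end TLPairs

namespace TLPairs

section Main

variable {d J₁ J₂ : ℕ} {m₁ m₂ : ℤ} {Q : ℝ}

lemma eq_two_of_isTLPairWith (hQ : 0 < Q) (h : IsTLPairWith d 1 Q J₁ m₁ J₂ m₂) : Q = 2 := by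
  rcases lt_or_gt_of_ne (h.weight_ne one_pos hQ) with hlt | hlt
  · exact (classification_one hQ h hlt).2.2
  · exact (classification_one hQ h.symm hlt).2.2

lemma isTLPair_comm {q : ℝ} : IsTLPair d q J₁ m₁ J₂ m₂ ↔ IsTLPair d q J₂ m₂ J₁ m₁ :=
  exists_congr fun _ => and_congr_right fun _ => isTLPairWith_comm

lemma isTLPair_one_iff_of_lt (hlt : m₁ < m₂) (hJ₁ : J₁ ≤ d) (hJ₂ : J₂ ≤ d)
    (hm₁ : |m₁| ≤ (J₁ : ℤ)) (hm₂ : |m₂| ≤ (J₂ : ℤ)) :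
    IsTLPair d 1 J₁ m₁ J₂ m₂ ↔ d = 2 ∧ ((m₁ = -1 ∧ m₂ = 1) ∨ (m₁ = -1 ∧ m₂ = 0 ∧ J₂ = 1) ∨
      (m₁ = 0 ∧ m₂ = 1 ∧ J₁ = 1)) := by
  constructor
  · rintro ⟨Q, hQ, h⟩
    have := classification_one hQ h hlt
    exact ⟨this.1, this.2.1⟩
  · rintro ⟨rfl, ⟨rfl, rfl⟩ | ⟨rfl, rfl, rfl⟩ | ⟨rfl, rfl, rfl⟩⟩
    · rw [abs_neg, abs_one] at hm₁
      rw [abs_one] at hm₂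
      exact ⟨_, by norm_num, isTLPairWith_opposite one_pos (by omega) (by omega) fun _ => rfl⟩
    · rw [abs_neg, abs_one] at hm₁
      exact ⟨2, by norm_num, isTLPairWith_neg_one_zero (by omega)⟩
    · rw [abs_one] at hm₂
      exact ⟨2, by norm_num, isTLPairWith_zero_one (by omega)⟩

/-- The pairs that are TL pairs for all `q`, written with increasing weights. -/
lemma isTLPair_all_iff_of_lt (hlt : m₁ < m₂) (hJ₁ : J₁ ≤ d) (hJ₂ : J₂ ≤ d)
    (hm₁ : |m₁| ≤ (J₁ : ℤ)) (hm₂ : |m₂| ≤ (J₂ : ℤ)) :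
    (∀ q : ℝ, 0 < q → IsTLPair d q J₁ m₁ J₂ m₂) ↔
      d = 2 ∧ m₁ = -1 ∧ m₂ = 1 ∧ J₁ ≠ J₂ := by
  constructor
  · intro h
    obtain ⟨rfl, h1⟩ := (isTLPair_one_iff_of_lt hlt hJ₁ hJ₂ hm₁ hm₂).1 (h 1 one_pos)
    obtain ⟨Q, hQ, h2⟩ := h 2 two_pos
    rcases h1 with ⟨rfl, rfl⟩ | ⟨rfl, rfl, rfl⟩ | ⟨rfl, rfl, rfl⟩
    · refine ⟨rfl, rfl, rfl, fun hJ => ?_⟩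
      have := (opposite_weights two_pos hQ h2).2 hJ
      norm_num at this
    · have := neg_one_zero two_pos hQ h2
      norm_num at this
    · have := zero_one two_pos hQ h2
      norm_num at this
  · rintro ⟨rfl, rfl, rfl, hne⟩ q hq
    rw [abs_neg, abs_one] at hm₁
    rw [abs_one] at hm₂
    exact ⟨_, by positivity, isTLPairWith_opposite hq (by omega) (by omega) fun h => (hne h).elim⟩

lemma ne_of_isTLPair {q : ℝ} (hq : 0 < q) (h : IsTLPair d q J₁ m₁ J₂ m₂) : m₁ ≠ m₂ := by
  obtain ⟨Q, hQ, h⟩ := h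
  exact h.weight_ne hq hQ

/-- The list of TL pairs at `q = 1`. -/
lemma isTLPair_one_iff (hJ₁ : J₁ ≤ d) (hJ₂ : J₂ ≤ d) (hm₁ : |m₁| ≤ (J₁ : ℤ))
    (hm₂ : |m₂| ≤ (J₂ : ℤ)) (hJ : J₂ ≤ J₁) :
    IsTLPair d 1 J₁ m₁ J₂ m₂ ↔
        d = 2 ∧ ∃ m : ℤ, (m = 1 ∨ m = -1) ∧
          (s((J₁, m₁), (J₂, m₂)) = s((1, m), (1, -m)) ∨
           s((J₁, m₁), (J₂, m₂)) = s((1, m), (1, 0)) ∨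
           s((J₁, m₁), (J₂, m₂)) = s((2, m), (1, -m)) ∨
           s((J₁, m₁), (J₂, m₂)) = s((2, m), (1, 0)) ∨
           s((J₁, m₁), (J₂, m₂)) = s((2, m), (2, -m))) := by
  constructor
  · intro h
    rcases lt_or_gt_of_ne (ne_of_isTLPair one_pos h) with hlt | hlt
    · obtain ⟨rfl, hc⟩ := (isTLPair_one_iff_of_lt hlt hJ₁ hJ₂ hm₁ hm₂).1 h
      refine ⟨rfl, ?_⟩
      rw [abs_le] at hm₁ hm₂
      rcases hc with ⟨rfl, rfl⟩ | ⟨rfl, rfl, rfl⟩ | ⟨rfl, rfl, rfl⟩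
      · obtain ⟨rfl, rfl⟩ | ⟨rfl, rfl⟩ | ⟨rfl, rfl⟩ : (J₁ = 1 ∧ J₂ = 1) ∨ (J₁ = 2 ∧ J₂ = 1) ∨
          (J₁ = 2 ∧ J₂ = 2) := by omega
        all_goals exact ⟨-1, Or.inr rfl, by decide⟩
      · obtain rfl | rfl : J₁ = 1 ∨ J₁ = 2 := by omega
        all_goals exact ⟨-1, Or.inr rfl, by decide⟩
      · obtain rfl : J₂ = 1 := by omega
        exact ⟨1, Or.inl rfl, by decide⟩
    · obtain ⟨rfl, hc⟩ :=
        (isTLPair_one_iff_of_lt hlt hJ₂ hJ₁ hm₂ hm₁).1 (isTLPair_comm.1 h)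
      refine ⟨rfl, ?_⟩
      rw [abs_le] at hm₁ hm₂
      rcases hc with ⟨rfl, rfl⟩ | ⟨rfl, rfl, rfl⟩ | ⟨rfl, rfl, rfl⟩
      · obtain ⟨rfl, rfl⟩ | ⟨rfl, rfl⟩ | ⟨rfl, rfl⟩ : (J₁ = 1 ∧ J₂ = 1) ∨ (J₁ = 2 ∧ J₂ = 1) ∨
          (J₁ = 2 ∧ J₂ = 2) := by omega
        all_goals exact ⟨1, Or.inl rfl, by decide⟩
      · obtain rfl : J₂ = 1 := by omega
        exact ⟨-1, Or.inr rfl, by decide⟩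
      · obtain rfl | rfl : J₁ = 1 ∨ J₁ = 2 := by omega
        all_goals exact ⟨1, Or.inl rfl, by decide⟩
  · rintro ⟨rfl, m, hm, h⟩
    have key : ∀ {J J' : ℕ} {k k' : ℤ}, J ≤ 2 → J' ≤ 2 → |k| ≤ (J : ℤ) → |k'| ≤ (J' : ℤ) →
        ((k = -1 ∧ k' = 1) ∨ (k = -1 ∧ k' = 0 ∧ J' = 1) ∨ (k = 0 ∧ k' = 1 ∧ J = 1)) →
        IsTLPair 2 1 J k J' k' := fun h1 h2 h3 h4 h5 =>
      (isTLPair_one_iff_of_lt (by omega) h1 h2 h3 h4).2 ⟨rfl, h5⟩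
    have h5 : ((m₁ = -1 ∧ m₂ = 1) ∨ (m₁ = -1 ∧ m₂ = 0 ∧ J₂ = 1) ∨
          (m₁ = 0 ∧ m₂ = 1 ∧ J₁ = 1)) ∨
        ((m₂ = -1 ∧ m₁ = 1) ∨ (m₂ = -1 ∧ m₁ = 0 ∧ J₁ = 1) ∨
          (m₂ = 0 ∧ m₁ = 1 ∧ J₂ = 1)) := by
      clear key hm₁ hm₂ hJ₁ hJ₂ hJ
      simp only [Sym2.eq_iff, Prod.mk.injEq] at h
      rcases hm with rfl | rfl <;>
        rcases h with
          (⟨⟨rfl, rfl⟩, rfl, rfl⟩ | ⟨⟨rfl, rfl⟩, rfl, rfl⟩) |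
          (⟨⟨rfl, rfl⟩, rfl, rfl⟩ | ⟨⟨rfl, rfl⟩, rfl, rfl⟩) |
          (⟨⟨rfl, rfl⟩, rfl, rfl⟩ | ⟨⟨rfl, rfl⟩, rfl, rfl⟩) |
          (⟨⟨rfl, rfl⟩, rfl, rfl⟩ | ⟨⟨rfl, rfl⟩, rfl, rfl⟩) |
          (⟨⟨rfl, rfl⟩, rfl, rfl⟩ | ⟨⟨rfl, rfl⟩, rfl, rfl⟩) <;>
        simp
    rcases h5 with h5 | h5
    · exact key hJ₁ hJ₂ hm₁ hm₂ h5
    · exact isTLPair_comm.1 (key hJ₂ hJ₁ hm₂ hm₁ h5)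

/-- The list of pairs that are TL pairs for all `q`. -/
lemma isTLPair_all_iff (hJ₁ : J₁ ≤ d) (hJ₂ : J₂ ≤ d) (hm₁ : |m₁| ≤ (J₁ : ℤ))
    (hm₂ : |m₂| ≤ (J₂ : ℤ)) (hJ : J₂ ≤ J₁) :
    (∀ q : ℝ, 0 < q → IsTLPair d q J₁ m₁ J₂ m₂) ↔
        d = 2 ∧
          ((J₁ = 2 ∧ m₁ = 1 ∧ J₂ = 1 ∧ m₂ = -1) ∨
           (J₁ = 2 ∧ m₁ = -1 ∧ J₂ = 1 ∧ m₂ = 1)) := by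
  rcases lt_trichotomy m₁ m₂ with hlt | heq | hlt
  · rw [isTLPair_all_iff_of_lt hlt hJ₁ hJ₂ hm₁ hm₂]
    rw [abs_le] at hm₁ hm₂
    omega
  · constructor
    · intro h
      exact absurd heq (ne_of_isTLPair one_pos (h 1 one_pos))
    · omega
  · simp only [isTLPair_comm (J₁ := J₁)]
    rw [isTLPair_all_iff_of_lt hlt hJ₂ hJ₁ hm₂ hm₁]
    rw [abs_le] at hm₁ hm₂
    omega

end Main

end TLPairs

theorem theorem6 (d J₁ J₂ : ℕ) (m₁ m₂ : ℤ)
    (hJ₁ : J₁ ≤ d) (hJ₂ : J₂ ≤ d) (hm₁ : |m₁| ≤ (J₁ : ℤ)) (hm₂ : |m₂| ≤ (J₂ : ℤ))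
    (hJ : J₂ ≤ J₁) :
    -- part a): the TL pairs at `q = 1`, and the value of `Q`
    ((TLPairs.IsTLPair d 1 J₁ m₁ J₂ m₂ ↔
        d = 2 ∧ ∃ m : ℤ, (m = 1 ∨ m = -1) ∧
          (s((J₁, m₁), (J₂, m₂)) = s((1, m), (1, -m)) ∨
           s((J₁, m₁), (J₂, m₂)) = s((1, m), (1, 0)) ∨
           s((J₁, m₁), (J₂, m₂)) = s((2, m), (1, -m)) ∨
           s((J₁, m₁), (J₂, m₂)) = s((2, m), (1, 0)) ∨
           s((J₁, m₁), (J₂, m₂)) = s((2, m), (2, -m)))) ∧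
      (TLPairs.IsTLPair d 1 J₁ m₁ J₂ m₂ →
        ∀ Q : ℝ, 0 < Q → (TLPairs.IsTLPairWith d 1 Q J₁ m₁ J₂ m₂ ↔ Q = 2))) ∧
    -- part b): the pairs that are TL pairs for all `q > 0`, and the value of `Q`
    (((∀ q : ℝ, 0 < q → TLPairs.IsTLPair d q J₁ m₁ J₂ m₂) ↔
        d = 2 ∧
          ((J₁ = 2 ∧ m₁ = 1 ∧ J₂ = 1 ∧ m₂ = -1) ∨
           (J₁ = 2 ∧ m₁ = -1 ∧ J₂ = 1 ∧ m₂ = 1))) ∧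
      ((∀ q : ℝ, 0 < q → TLPairs.IsTLPair d q J₁ m₁ J₂ m₂) →
        ∀ q : ℝ, 0 < q → ∀ Q : ℝ, 0 < Q →
          (TLPairs.IsTLPairWith d q Q J₁ m₁ J₂ m₂ ↔ Q = q ^ 2 + (q ^ 2)⁻¹))) := by
  have hall := TLPairs.isTLPair_all_iff hJ₁ hJ₂ hm₁ hm₂ hJ
  refine ⟨⟨TLPairs.isTLPair_one_iff hJ₁ hJ₂ hm₁ hm₂ hJ, ?_⟩, hall, ?_⟩
  · rintro ⟨Q₀, hQ₀, h₀⟩ Q hQ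
    refine ⟨TLPairs.eq_two_of_isTLPairWith hQ, ?_⟩
    rintro rfl
    rwa [TLPairs.eq_two_of_isTLPairWith hQ₀ h₀] at h₀
  · intro h q hq Q hQ
    obtain ⟨rfl, ⟨rfl, rfl, rfl, rfl⟩ | ⟨rfl, rfl, rfl, rfl⟩⟩ := hall.1 h
    · rw [TLPairs.isTLPairWith_comm]
      refine ⟨fun h => (TLPairs.opposite_weights hq hQ h).1, ?_⟩
      rintro rfl
      exact TLPairs.isTLPairWith_opposite hq (by omega) (by omega) (by omega)
    · refine ⟨fun h => (TLPairs.opposite_weights hq hQ h).1, ?_⟩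
      rintro rfl
      exact TLPairs.isTLPairWith_opposite hq (by omega) (by omega) (by omega)
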